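/- Let $\kappa$ be a cardinal and let $\kappa\mathrm{Set}$ be the category of sets of cardinality $<\kappa$. A category (possibly with a proper class of objects) is locally $\kappa$-small if all its hom-sets have cardinality $<\kappa$, and $\kappa$-small if it has fewer than $\kappa$ morphisms. Let $\mathrm{Cat}_\kappa$ consist of the following data. Objects: locally $\kappa$-small categories; small objects: the $\kappa$-small ones; vertical arrows: functors; horizontal arrows $R:C\nrightarrow D$: functors $C^{o}\times D\to\kappa\mathrm{Set}$; 2-cells $(R_1,\dots,R_n)\Rightarrow S$ framed by $F:C_0\to D$ and $G:C_n\to D'$ ($n\ge 0$, $R_i:C_{i-1}\nrightarrow C_i$, $S:D\nrightarrow D'$): families of maps $R_1(c_0,c_1)\times\dots\times R_n(c_{n-1},c_n)\to S(Fc_0,Gc_n)$, natural in $c_0,c_n$ and dinatural in $c_1,\dots,c_{n-1}$ (for $n=0$: families $\varphi_c\in S(Fc,Gc)$ with $S(1,Gh)\varphi_c=S(Fh,1)\varphi_{c'}$ for all $h:c\to c'$), composed by substitution; restrictions: $R(F,G)=R\circ(F^{o}\times G)$ with the 2-cell $R(F,G)\Rightarrow R$ that is the identity on elements. Write $\mathcal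 V_o(A,B)$ for the set of vertical arrows and $\mathcal V_2(\vec R;f;g;S)$ for the set of 2-cells from the string $\vec R$ to $S$ framed by $f$ and $g$. **(1)** $\mathrm{Cat}_\kappa$ is a virtual double category: composition of 2-cells is associative and unital. **(2)** It is split fibrant: the chosen 2-cells $R(F,G)\Rightarrow R$ are cartesian, and the choice is strictly functorial, i.e. $R(1,1)=R$ and $R(FF',GG')=R(F,G)(F',G')$, and likewise for the chosen 2-cells. **(3)** Suppose moreover that $\kappa$ is an infinite regular strong limit cardinal (for instance, inaccessible). Then $\mathcal V=\mathrm{Cat}_\kappa$ has a choice of all of the following, where the bijections for categories are natural in $A$ and those between sets of 2-cells are given by composition with a universal 2-cell. *Categories.* - A terminal object $1$, binary products $B\times C$ in the vertical category, and for each $R:B\nrightarrow C$ a tabulator $\int R$, with $\mathcal V_o(A,\int R)\cong\sum_{f:A\to B}\sum_{g:A\to C}\mathcal V_2(\cdot\,;f;g;R)$. The object $1$ is small, and $B\times C$ and $\int R$ are small if $B$ and $C$ are. - For each small $C$, presheaf objects $\mathcal P^-C$ and $\mathcal P^+C$: vertical arrows $A\to\mathcal P^-C$ correspond to horizontal arrows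 $C\nrightarrow A$, and vertical arrows $A\to\mathcal P^+C$ to horizontal arrows $A\nrightarrow C$; here precomposition corresponds to restriction. *Sets.* - Units $U_C:C\nrightarrow C$ for all $C$: $\mathcal V_2(\vec P,U_C,\vec Q;f;g;R)\cong\mathcal V_2(\vec P,\vec Q;f;g;R)$. - Tensors $P\odot Q:C\nrightarrow E$ for all $P:C\nrightarrow D$, $Q:D\nrightarrow E$ with $D$ small: $\mathcal V_2(\vec R,P\odot Q,\vec S;f;g;T)\cong\mathcal V_2(\vec R,P,Q,\vec S;f;g;T)$. - Covariant homs $P\triangleright Q:C\nrightarrow B$ for all $P:B\nrightarrow D$, $Q:C\nrightarrow D$ with $D$ small: $\mathcal V_2(\vec R;f;\mathrm{id};P\triangleright Q)\cong\mathcal V_2(\vec R,P;f;\mathrm{id};Q)$. - Contravariant homs $P\triangleleft Q:B\nrightarrow C$ for all $P:D\nrightarrow C$, $Q:D\nrightarrow B$ with $D$ small: $\mathcal V_2(\vec R;\mathrm{id};g;P\triangleleft Q)\cong\mathcal V_2(Q,\vec R;\mathrm{id};g;P)$. - Nullary products $1_{C,D}:C\nrightarrow D$ for all $C,D$: $\mathcal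 V_2(\vec P;f;g;1_{C,D})$ has exactly one element. - Binary products $P\times Q$ of horizontal arrows $P,Q:C\nrightarrow D$: $\mathcal V_2(\vec R;f;g;P\times Q)\cong\mathcal V_2(\vec R;f;g;P)\times\mathcal V_2(\vec R;f;g;Q)$. The choices of tensors, homs and products of horizontal arrows commute strictly with restriction: $(P\odot Q)(f,g)=P(f,\mathrm{id})\odot Q(\mathrm{id},g)$, $(P\triangleright Q)(f,g)=P(g,\mathrm{id})\triangleright Q(f,\mathrm{id})$, $(P\triangleleft Q)(f,g)=P(\mathrm{id},g)\triangleleft Q(\mathrm{id},f)$, $1(f,g)=1$ and $(P\times Q)(f,g)=P(f,g)\times Q(f,g)$. -/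

import Mathlib

open CategoryTheory Opposite

universe u w₁ w₂ w₃ w₄

namespace VETT

/-! ### Virtual double categories -/

/-- Composable strings `R₁, …, Rₙ` (`n ≥ 0`) of horizontal arrows from `A` to `B`. -/
inductive HPath {O : Type w₁} (H : O → O → Type w₃) : O → O → Type (max w₁ w₃)
  | nil (A : O) : HPath H A A
  | cons {A B C : O} (R : H A B) (p : HPath H B C) : HPath H A C

namespace HPath

variable {O : Type w₁} {H : O → O → Type w₃}

/-- The string consisting of a single horizontal arrow. -/
def single {A B : O} (R : H A B) : HPath H A B := .cons R (.nil B)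

/-- Concatenation of strings. -/
def append : {A B C : O} → HPath H A B → HPath H B C → HPath H A C
  | _, _, _, .nil _, q => q
  | _, _, _, .cons R p, q => .cons R (append p q)

theorem append_nil : {A B : O} → (p : HPath H A B) → p.append (.nil B) = p
  | _, _, .nil _ => rfl
  | _, _, .cons R p => congrArg (HPath.cons R) (append_nil p)

theorem append_assoc : {A B C D : O} → (p : HPath H A B) → (q : HPath H B C) →
    (r : HPath H C D) → (p.append q).append r = p.append (q.append r)
  | _, _, _, _, .nil _, _, _ => rfl
  | _, _, _, _, .cons R p, q, r => congrArg (HPath.cons R) (append_assoc p q r)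

end HPath

/-- The underlying cells of a virtual double category: a category of objects and vertical
arrows, horizontal arrows `Hor A B` with source `A` and target `B`, and, for each string `p` of
horizontal arrows from `A` to `B`, each `S : Hor A' B'` and each pair of vertical arrows
`f : A ⟶ A'`, `g : B ⟶ B'`, the 2-cells `p ⇒ S` framed by `f` and `g`. -/
structure VDGraph where
  Obj : Type w₁
  [category : Category.{w₂} Obj]
  Hor : Obj → Obj → Type w₃
  Cell : ∀ {A B A' B' : Obj}, HPath Hor A B → Hor A' B' → (A ⟶ A') → (B ⟶ B') → Type w₄

attribute [instance] VDGraph.category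

/-- Rows of horizontally adjacent 2-cells.  A `Row p q f g` with `q = S₁, …, Sₙ` consists of a
decomposition of `p` as a concatenation `p₁ ⋯ pₙ` and of 2-cells `φᵢ : pᵢ ⇒ Sᵢ` framed by
`fᵢ₋₁` and `fᵢ`, where `f₀ = f` and `fₙ = g`.  For `n = 0` it is a single vertical arrow. -/
inductive Row (G : VDGraph.{w₁, w₂, w₃, w₄}) : {A B A' B' : G.Obj} → HPath G.Hor A B →
    HPath G.Hor A' B' → (A ⟶ A') → (B ⟶ B') → Type (max w₁ w₂ w₃ w₄)
  | nil {A A' : G.Obj} (f : A ⟶ A') : Row G (.nil A) (.nil A') f f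
  | cons {A B C A' B' C' : G.Obj} {p : HPath G.Hor A B} {S : G.Hor A' B'} {f : A ⟶ A'}
      {g : B ⟶ B'} (φ : G.Cell p S f g) {q : HPath G.Hor B C} {s : HPath G.Hor B' C'}
      {h : C ⟶ C'} (ρ : Row G q s g h) {r : HPath G.Hor A C} (e : r = p.append q) :
      Row G r (.cons S s) f h

namespace Row

variable {G : VDGraph.{w₁, w₂, w₃, w₄}}

/-- The row consisting of one 2-cell. -/
def single {A B A' B' : G.Obj} {p : HPath G.Hor A B} {S : G.Hor A' B'} {f : A ⟶ A'}
    {g : B ⟶ B'} (φ : G.Cell p S f g) : Row G p (.single S) f g :=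
  .cons φ (.nil g) p.append_nil.symm

/-- Horizontal juxtaposition of rows. -/
def append : {A B C A' B' C' : G.Obj} → {p : HPath G.Hor A B} → {p' : HPath G.Hor A' B'} →
    {q : HPath G.Hor B C} → {q' : HPath G.Hor B' C'} → {f : A ⟶ A'} → {g : B ⟶ B'} →
    {h : C ⟶ C'} → Row G p p' f g → Row G q q' g h → Row G (p.append q) (p'.append q') f h
  | _, _, _, _, _, _, _, _, _, _, _, _, _, .nil _, σ => σ
  | _, _, _, _, _, _, _, _, _, _, _, _, _, .cons φ ρ e, σ =>
      .cons φ (append ρ σ) (by rw [e, HPath.append_assoc])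

/-- The result of cutting a row over `q₁ ⋯ q₂` into a row over `q₁` and a row over `q₂`. -/
structure Split {A C A' B' C' : G.Obj} (p : HPath G.Hor A C) (q₁ : HPath G.Hor A' B')
    (q₂ : HPath G.Hor B' C') (f : A ⟶ A') (h : C ⟶ C') where
  {mid : G.Obj}
  {frame : mid ⟶ B'}
  {top₁ : HPath G.Hor A mid}
  {top₂ : HPath G.Hor mid C}
  row₁ : Row G top₁ q₁ f frame
  row₂ : Row G top₂ q₂ frame h
  eq : p = top₁.append top₂

/-- Cut a row over a concatenation in two. -/
def split : {A C A' B' C' : G.Obj} → {p : HPath G.Hor A C} → (q₁ : HPath G.Hor A' B') →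
    {q₂ : HPath G.Hor B' C'} → {f : A ⟶ A'} → {h : C ⟶ C'} →
    Row G p (q₁.append q₂) f h → Split p q₁ q₂ f h
  | _, _, _, _, _, _, .nil _, _, f, _, α => ⟨.nil f, α, rfl⟩
  | _, _, _, _, _, p, .cons S q₁, q₂, f, h, α =>
      match (show Row G p (.cons S (q₁.append q₂)) f h from α) with
      | .cons φ ρ e =>
        let s := split q₁ ρ
        ⟨.cons φ s.row₁ rfl, s.row₂,
          e.trans ((congrArg _ s.eq).trans (HPath.append_assoc _ _ _).symm)⟩

end Row

/-- A virtual double category without its laws: identity 2-cells, and the composition of a row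
`φ₁, …, φₙ` of 2-cells `φᵢ : pᵢ ⇒ Sᵢ` with a 2-cell `S₁, …, Sₙ ⇒ T`. -/
structure PreVDC extends VDGraph.{w₁, w₂, w₃, w₄} where
  idCell : ∀ {A B : Obj} (R : Hor A B), Cell (.single R) R (𝟙 A) (𝟙 B)
  comp : ∀ {A B A' B' A'' B'' : Obj} {p : HPath Hor A B} {q : HPath Hor A' B'}
    {T : Hor A'' B''} {f : A ⟶ A'} {g : B ⟶ B'} {h : A' ⟶ A''} {k : B' ⟶ B''},
    Row toVDGraph p q f g → Cell q T h k → Cell p T (f ≫ h) (g ≫ k)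

namespace PreVDC

variable (V : PreVDC.{w₁, w₂, w₃, w₄})

/-- The row of identity 2-cells on a string of horizontal arrows. -/
def idRow : {A B : V.Obj} → (p : HPath V.Hor A B) → Row V.toVDGraph p p (𝟙 A) (𝟙 B)
  | _, _, .nil A => .nil (𝟙 A)
  | _, _, .cons R p => .cons (V.idCell R) (idRow p) rfl

/-- Vertical composition of rows: each 2-cell of the lower row is composed with the part of the
upper row above it. -/
def rowComp : {A B A' B' A'' B'' : V.Obj} → {p : HPath V.Hor A B} → {q : HPath V.Hor A' B'} →
    {r : HPath V.Hor A'' B''} → {f : A ⟶ A'} → {g : B ⟶ B'} → {h : A' ⟶ A''} →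
    {k : B' ⟶ B''} → Row V.toVDGraph p q f g → Row V.toVDGraph q r h k →
    Row V.toVDGraph p r (f ≫ h) (g ≫ k)
  | _, _, _, _, _, _, _, _, _, _, _, _, _, .nil f, .nil h => .nil (f ≫ h)
  | _, _, _, _, _, _, _, _, _, _, _, _, _, α, .cons (p := q₁) φ ρ e =>
      let s := Row.split q₁ (e ▸ α)
      .cons (V.comp s.row₁ φ) (rowComp s.row₂ ρ) s.eq

/-- Replace the frames of a 2-cell by equal ones. -/
def reframe {A B A' B' : V.Obj} {p : HPath V.Hor A B} {S : V.Hor A' B'} {f f' : A ⟶ A'}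
    {g g' : B ⟶ B'} (hf : f = f') (hg : g = g') (φ : V.Cell p S f g) : V.Cell p S f' g' :=
  hf ▸ hg ▸ φ

/-- The laws of a virtual double category: composition of 2-cells is associative and unital. -/
structure IsVirtualDoubleCategory : Prop where
  id_comp : ∀ {A B A' B' : V.Obj} {p : HPath V.Hor A B} {S : V.Hor A' B'} {f : A ⟶ A'}
    {g : B ⟶ B'} (φ : V.Cell p S f g),
    V.reframe (Category.id_comp f) (Category.id_comp g) (V.comp (V.idRow p) φ) = φ
  comp_id : ∀ {A B A' B' : V.Obj} {p : HPath V.Hor A B} {S : V.Hor A' B'} {f : A ⟶ A'}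
    {g : B ⟶ B'} (φ : V.Cell p S f g),
    V.reframe (Category.comp_id f) (Category.comp_id g)
      (V.comp (Row.single φ) (V.idCell S)) = φ
  assoc : ∀ {A B A' B' A'' B'' X Y : V.Obj} {p : HPath V.Hor A B} {q : HPath V.Hor A' B'}
    {r : HPath V.Hor A'' B''} {T : V.Hor X Y} {f : A ⟶ A'} {g : B ⟶ B'} {h : A' ⟶ A''}
    {k : B' ⟶ B''} {l : A'' ⟶ X} {m : B'' ⟶ Y} (α : Row V.toVDGraph p q f g)
    (β : Row V.toVDGraph q r h k) (φ : V.Cell r T l m),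
    V.reframe (Category.assoc f h l) (Category.assoc g k m) (V.comp (V.rowComp α β) φ) =
      V.comp α (V.comp β φ)

/-- A choice, for each `R : Hor A B` and vertical arrows `f : A' ⟶ A`, `g : B' ⟶ B`, of a
horizontal arrow `R(f, g) : Hor A' B'` and of a 2-cell `R(f, g) ⇒ R` framed by `f` and `g`. -/
structure Restrictions where
  restr : ∀ {A B A' B' : V.Obj}, (A' ⟶ A) → (B' ⟶ B) → V.Hor A B → V.Hor A' B'
  cell : ∀ {A B A' B' : V.Obj} (f : A' ⟶ A) (g : B' ⟶ B) (R : V.Hor A B),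
    V.Cell (.single (restr f g R)) R f g

end PreVDC

variable {V : PreVDC.{w₁, w₂, w₃, w₄}}

/-- The chosen 2-cells `R(f, g) ⇒ R` are cartesian, and the choice is strictly functorial. -/
structure PreVDC.Restrictions.IsSplitFibrant (ρ : V.Restrictions) : Prop where
  cartesian : ∀ {A B A' B' X Y : V.Obj} (f : A' ⟶ A) (g : B' ⟶ B) (R : V.Hor A B)
    (p : HPath V.Hor X Y) (h : X ⟶ A') (k : Y ⟶ B'),
    Function.Bijective (fun φ : V.Cell p (ρ.restr f g R) h k =>
      V.comp (Row.single φ) (ρ.cell f g R))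
  restr_id : ∀ {A B : V.Obj} (R : V.Hor A B), ρ.restr (𝟙 A) (𝟙 B) R = R
  restr_comp : ∀ {A B A' B' A'' B'' : V.Obj} (f' : A'' ⟶ A') (f : A' ⟶ A) (g' : B'' ⟶ B')
    (g : B' ⟶ B) (R : V.Hor A B),
    ρ.restr (f' ≫ f) (g' ≫ g) R = ρ.restr f' g' (ρ.restr f g R)
  cell_id : ∀ {A B : V.Obj} (R : V.Hor A B), HEq (ρ.cell (𝟙 A) (𝟙 B) R) (V.idCell R)
  cell_comp : ∀ {A B A' B' A'' B'' : V.Obj} (f' : A'' ⟶ A') (f : A' ⟶ A) (g' : B'' ⟶ B')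
    (g : B' ⟶ B) (R : V.Hor A B),
    HEq (ρ.cell (f' ≫ f) (g' ≫ g) R)
      (V.comp (Row.single (ρ.cell f' g' (ρ.restr f g R))) (ρ.cell f g R))

/-! ### Universal properties of category connectives -/

/-- A contravariant presheaf object of `C`: vertical arrows `A ⟶ 𝒫⁻C` correspond to horizontal
arrows from `C` to `A`, naturally in `A`. -/
structure NegPresheafObject (ρ : V.Restrictions) (C : V.Obj) where
  obj : V.Obj
  equiv : ∀ A : V.Obj, (A ⟶ obj) ≃ V.Hor C A
  natural : ∀ {A A' : V.Obj} (k : A' ⟶ A) (f : A ⟶ obj),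
    equiv A' (k ≫ f) = ρ.restr (𝟙 C) k (equiv A f)

/-- A covariant presheaf object of `C`: vertical arrows `A ⟶ 𝒫⁺C` correspond to horizontal
arrows from `A` to `C`, naturally in `A`. -/
structure PosPresheafObject (ρ : V.Restrictions) (C : V.Obj) where
  obj : V.Obj
  equiv : ∀ A : V.Obj, (A ⟶ obj) ≃ V.Hor A C
  natural : ∀ {A A' : V.Obj} (k : A' ⟶ A) (f : A ⟶ obj),
    equiv A' (k ≫ f) = ρ.restr k (𝟙 C) (equiv A f)

/-- A tabulator of `R`: vertical arrows `A ⟶ ∫R` correspond to triples of vertical arrows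
`f : A ⟶ B`, `g : A ⟶ C` and a 2-cell from the empty string at `A` to `R` framed by `f` and
`g`, naturally in `A`. -/
structure Tabulator {B C : V.Obj} (R : V.Hor B C) where
  obj : V.Obj
  equiv : ∀ A : V.Obj, (A ⟶ obj) ≃ Σ (f : A ⟶ B) (g : A ⟶ C), V.Cell (.nil A) R f g
  natural : ∀ {A A' : V.Obj} (k : A' ⟶ A) (f : A ⟶ obj),
    equiv A' (k ≫ f) =
      ⟨k ≫ (equiv A f).1, k ≫ (equiv A f).2.1, V.comp (Row.nil k) (equiv A f).2.2⟩

/-- A binary product in the vertical category: vertical arrows `A ⟶ B × C` correspond to pairs,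
naturally in `A`. -/
structure ProductObject (B C : V.Obj) where
  obj : V.Obj
  equiv : ∀ A : V.Obj, (A ⟶ obj) ≃ (A ⟶ B) × (A ⟶ C)
  natural : ∀ {A A' : V.Obj} (k : A' ⟶ A) (f : A ⟶ obj),
    equiv A' (k ≫ f) = (k ≫ (equiv A f).1, k ≫ (equiv A f).2)

/-! ### Universal properties of set connectives

The natural bijections between sets of 2-cells are those given by composition with a universal
2-cell. -/

/-- A unit `U_C`: 2-cells `p, U_C, q ⇒ S` correspond to 2-cells `p, q ⇒ S`. -/
structure UnitArrow (C : V.Obj) where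
  arrow : V.Hor C C
  cell : V.Cell (.nil C) arrow (𝟙 C) (𝟙 C)
  universal : ∀ {A B A' B' : V.Obj} (p : HPath V.Hor A C) (q : HPath V.Hor C B)
    (S : V.Hor A' B') (f : A ⟶ A') (g : B ⟶ B'),
    Function.Bijective (fun φ : V.Cell (p.append (.cons arrow q)) S f g =>
      (V.comp ((V.idRow p).append (.cons cell (V.idRow q) rfl)) φ :
        V.Cell (p.append q) S (𝟙 A ≫ f) (𝟙 B ≫ g)))

/-- A tensor `P ⊙ Q`: 2-cells `p, P ⊙ Q, q ⇒ S` correspond to 2-cells `p, P, Q, q ⇒ S`. -/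
structure Tensor {C D E : V.Obj} (P : V.Hor C D) (Q : V.Hor D E) where
  arrow : V.Hor C E
  cell : V.Cell (.cons P (.single Q)) arrow (𝟙 C) (𝟙 E)
  universal : ∀ {A B A' B' : V.Obj} (p : HPath V.Hor A C) (q : HPath V.Hor E B)
    (S : V.Hor A' B') (f : A ⟶ A') (g : B ⟶ B'),
    Function.Bijective (fun φ : V.Cell (p.append (.cons arrow q)) S f g =>
      (V.comp ((V.idRow p).append (.cons cell (V.idRow q) rfl)) φ :
        V.Cell (p.append (.cons P (.cons Q q))) S (𝟙 A ≫ f) (𝟙 B ≫ g)))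

/-- A covariant hom `P ▷ Q`: 2-cells `p ⇒ P ▷ Q` with identity right frame correspond to
2-cells `p, P ⇒ Q` with identity right frame. -/
structure CovHom {B C D : V.Obj} (P : V.Hor B D) (Q : V.Hor C D) where
  arrow : V.Hor C B
  cell : V.Cell (.cons arrow (.single P)) Q (𝟙 C) (𝟙 D)
  universal : ∀ {X : V.Obj} (p : HPath V.Hor X B) (f : X ⟶ C),
    Function.Bijective (fun φ : V.Cell p arrow f (𝟙 B) =>
      (V.comp (.cons φ (V.idRow (.single P)) rfl) cell :
        V.Cell (p.append (.single P)) Q (f ≫ 𝟙 C) (𝟙 D ≫ 𝟙 D)))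

/-- A contravariant hom `P ◁ Q`: 2-cells `p ⇒ P ◁ Q` with identity left frame correspond to
2-cells `Q, p ⇒ P` with identity left frame. -/
structure ContraHom {B C D : V.Obj} (P : V.Hor D C) (Q : V.Hor D B) where
  arrow : V.Hor B C
  cell : V.Cell (.cons Q (.single arrow)) P (𝟙 D) (𝟙 C)
  universal : ∀ {X : V.Obj} (p : HPath V.Hor B X) (g : X ⟶ C),
    Function.Bijective (fun φ : V.Cell p arrow (𝟙 B) g =>
      (V.comp (.cons (V.idCell Q) (Row.single φ) rfl) cell :
        V.Cell (.cons Q p) P (𝟙 D ≫ 𝟙 D) (g ≫ 𝟙 C)))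

/-- A nullary product of horizontal arrows from `C` to `D`: there is exactly one 2-cell into it
with given domain and frames. -/
structure TerminalArrow (C D : V.Obj) where
  arrow : V.Hor C D
  universal : ∀ {A B : V.Obj} (p : HPath V.Hor A B) (f : A ⟶ C) (g : B ⟶ D),
    Nonempty (Unique (V.Cell p arrow f g))

/-- A binary product of horizontal arrows: 2-cells `p ⇒ P × Q` correspond to pairs of 2-cells
`p ⇒ P`, `p ⇒ Q` with the same frames. -/
structure ProductArrow {C D : V.Obj} (P Q : V.Hor C D) where
  arrow : V.Hor C D
  fst : V.Cell (.single arrow) P (𝟙 C) (𝟙 D)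
  snd : V.Cell (.single arrow) Q (𝟙 C) (𝟙 D)
  universal : ∀ {A B : V.Obj} (p : HPath V.Hor A B) (f : A ⟶ C) (g : B ⟶ D),
    Function.Bijective (fun φ : V.Cell p arrow f g =>
      (V.comp (Row.single φ) fst, V.comp (Row.single φ) snd))

/-- A choice of category connectives: finite products and tabulators, which are small when built
from small objects, and presheaf objects of small objects. -/
structure CategoryConnectives (ρ : V.Restrictions) (small : Set V.Obj) where
  one : V.Obj
  one_universal : ∀ A : V.Obj, Nonempty (Unique (A ⟶ one))
  one_small : one ∈ small
  prod : ∀ B C : V.Obj, ProductObject B C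
  prod_small : ∀ B C : V.Obj, B ∈ small → C ∈ small → (prod B C).obj ∈ small
  tabulator : ∀ {B C : V.Obj} (R : V.Hor B C), Tabulator R
  tabulator_small : ∀ {B C : V.Obj} (R : V.Hor B C), B ∈ small → C ∈ small →
    (tabulator R).obj ∈ small
  negPresheaf : ∀ C ∈ small, NegPresheafObject ρ C
  posPresheaf : ∀ C ∈ small, PosPresheafObject ρ C

/-- A choice of set connectives: units for all objects, tensors and homs over small objects, and
all finite products of horizontal arrows; all but the units commute strictly with restriction. -/
structure SetConnectives (ρ : V.Restrictions) (small : Set V.Obj) where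
  unit : ∀ C : V.Obj, UnitArrow C
  tensor : ∀ {C D E : V.Obj}, D ∈ small → ∀ (P : V.Hor C D) (Q : V.Hor D E), Tensor P Q
  covHom : ∀ {B C D : V.Obj}, D ∈ small → ∀ (P : V.Hor B D) (Q : V.Hor C D), CovHom P Q
  contraHom : ∀ {B C D : V.Obj}, D ∈ small → ∀ (P : V.Hor D C) (Q : V.Hor D B), ContraHom P Q
  top : ∀ C D : V.Obj, TerminalArrow C D
  times : ∀ {C D : V.Obj} (P Q : V.Hor C D), ProductArrow P Q
  tensor_restr : ∀ {C D E C' E' : V.Obj} (hD : D ∈ small) (P : V.Hor C D) (Q : V.Hor D E)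
    (f : C' ⟶ C) (g : E' ⟶ E),
    ρ.restr f g (tensor hD P Q).arrow =
      (tensor hD (ρ.restr f (𝟙 D) P) (ρ.restr (𝟙 D) g Q)).arrow
  covHom_restr : ∀ {B C D B' C' : V.Obj} (hD : D ∈ small) (P : V.Hor B D) (Q : V.Hor C D)
    (f : C' ⟶ C) (g : B' ⟶ B),
    ρ.restr f g (covHom hD P Q).arrow =
      (covHom hD (ρ.restr g (𝟙 D) P) (ρ.restr f (𝟙 D) Q)).arrow
  contraHom_restr : ∀ {B C D B' C' : V.Obj} (hD : D ∈ small) (P : V.Hor D C) (Q : V.Hor D B)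
    (f : B' ⟶ B) (g : C' ⟶ C),
    ρ.restr f g (contraHom hD P Q).arrow =
      (contraHom hD (ρ.restr (𝟙 D) g P) (ρ.restr (𝟙 D) f Q)).arrow
  top_restr : ∀ {C D C' D' : V.Obj} (f : C' ⟶ C) (g : D' ⟶ D),
    ρ.restr f g (top C D).arrow = (top C' D').arrow
  times_restr : ∀ {C D C' D' : V.Obj} (P Q : V.Hor C D) (f : C' ⟶ C) (g : D' ⟶ D),
    ρ.restr f g (times P Q).arrow = (times (ρ.restr f g P) (ρ.restr f g Q)).arrow

/-! ### Locally `κ`-small categories -/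

/-- The category of sets of cardinality less than `κ`. -/
abbrev KSet (κ : Cardinal.{u}) : Type (u + 1) :=
  ObjectProperty.FullSubcategory (fun X : Type u => Cardinal.mk X < κ)

/-- A (possibly large) category all of whose hom-sets have cardinality less than `κ`. -/
structure LocSmallCat (κ : Cardinal.{u}) : Type (u + 2) where
  carrier : Type (u + 1)
  [category : Category.{u} carrier]
  hom_lt : ∀ x y : carrier, Cardinal.mk (x ⟶ y) < κ

attribute [instance] LocSmallCat.category

/-- The category of locally `κ`-small categories and functors. -/
instance LocSmallCat.instCategory (κ : Cardinal.{u}) : Category.{u + 1} (LocSmallCat κ) where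
  Hom C D := C.carrier ⥤ D.carrier
  id C := 𝟭 C.carrier
  comp F G := F ⋙ G

/-- The `κ`-small categories: those with fewer than `κ` morphisms. -/
def smallCats (κ : Cardinal.{u}) : Set (LocSmallCat κ) :=
  {C | HasCardinalLT (Arrow C.carrier) κ}

section

variable {κ : Cardinal.{u}}

/-- The functor underlying a vertical arrow. -/
abbrev functorOf {C D : LocSmallCat κ} (F : C ⟶ D) : C.carrier ⥤ D.carrier := F

/-- Profunctors from `C` to `D`: functors from `Cᵒᵖ × D` to sets of cardinality less than
`κ`. -/
abbrev Prof (C D : LocSmallCat κ) : Type (u + 1) := C.carrierᵒᵖ × D.carrier ⥤ KSet κ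

namespace Prof

variable {C D : LocSmallCat κ}

/-- The elements `R(c, d)` of a profunctor. -/
abbrev El (R : Prof C D) (c : C.carrier) (d : D.carrier) : Type u := (R.obj (op c, d)).obj

/-- The contravariant action `R(h, 1)`. -/
def lact (R : Prof C D) {c c' : C.carrier} (h : c ⟶ c') {d : D.carrier} (x : R.El c' d) :
    R.El c d :=
  (R.map (Prod.mkHom h.op (𝟙 d))).hom x

/-- The covariant action `R(1, k)`. -/
def ract (R : Prof C D) {c : C.carrier} {d d' : D.carrier} (k : d ⟶ d') (x : R.El c d) :
    R.El c d' :=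
  (R.map (Prod.mkHom (𝟙 (op c)) k)).hom x

end Prof

/-- Strings of elements of a string `R₁, …, Rₙ` of profunctors from `C₀` to `Cₙ`: objects
`c = c₀, c₁, …, cₙ = d` with `cᵢ` in `Cᵢ` and elements `xᵢ` of `Rᵢ(cᵢ₋₁, cᵢ)`. -/
inductive Elts : {C D : LocSmallCat κ} → HPath (Prof (κ := κ)) C D → C.carrier → D.carrier →
    Type (u + 2)
  | nil {C : LocSmallCat κ} (c : C.carrier) : Elts (.nil C) c c
  | cons {C D E : LocSmallCat κ} {R : Prof C D} {p : HPath (Prof (κ := κ)) D E} {c : C.carrier}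
      {d : D.carrier} {e : E.carrier} (x : R.El c d) (xs : Elts p d e) : Elts (.cons R p) c e

/-- `EltsHom xs ys h k` says that there are morphisms `hᵢ : cᵢ ⟶ c'ᵢ` between the objects of
`xs` and `ys`, with `h₀ = h` and `hₙ = k`, such that `Rᵢ(1, hᵢ)(xᵢ) = Rᵢ(hᵢ₋₁, 1)(yᵢ)` in
`Rᵢ(cᵢ₋₁, c'ᵢ)` for all `i`. -/
inductive EltsHom : {C D : LocSmallCat κ} → {p : HPath (Prof (κ := κ)) C D} →
    {c c' : C.carrier} → {d d' : D.carrier} → Elts p c d → Elts p c' d' → (c ⟶ c') →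
    (d ⟶ d') → Prop
  | nil {C : LocSmallCat κ} {c c' : C.carrier} (h : c ⟶ c') :
      EltsHom (Elts.nil c) (Elts.nil c') h h
  | cons {C D E : LocSmallCat κ} {R : Prof C D} {p : HPath (Prof (κ := κ)) D E}
      {c c' : C.carrier} {d d' : D.carrier} {e e' : E.carrier} {x : R.El c d} {y : R.El c' d'}
      {xs : Elts p d e} {ys : Elts p d' e'} {h : c ⟶ c'} {k : d ⟶ d'} {l : e ⟶ e'}
      (sq : R.ract k x = R.lact h y) (t : EltsHom xs ys k l) :
      EltsHom (Elts.cons x xs) (Elts.cons y ys) h l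

/-- Morphisms of profunctors `R₁, …, Rₙ ⇒ S` framed by functors `F` and `G`: families of maps
`R₁(c₀, c₁) × ⋯ × Rₙ(cₙ₋₁, cₙ) → S(F c₀, G cₙ)` that are natural.

The condition `natural` is naturality in `c₀` and `cₙ` together with dinaturality in the
intermediate objects, as one sees by letting all but one of the morphisms of `EltsHom` be
identities; for `n = 0` it says that `φ c ∈ S(F c, G c)` satisfies
`S(1, G h)(φ c) = S(F h, 1)(φ c')` for all `h : c ⟶ c'`. -/
@[ext]
structure ProfCell {C D C' D' : LocSmallCat κ} (p : HPath (Prof (κ := κ)) C D) (S : Prof C' D')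
    (F : C ⟶ C') (G : D ⟶ D') : Type (u + 2) where
  app : ∀ {c : C.carrier} {d : D.carrier}, Elts p c d →
    S.El ((functorOf F).obj c) ((functorOf G).obj d)
  natural : ∀ {c c' : C.carrier} {d d' : D.carrier} {xs : Elts p c d} {ys : Elts p c' d'}
    {h : c ⟶ c'} {k : d ⟶ d'}, EltsHom xs ys h k →
    S.ract ((functorOf G).map k) (app xs) = S.lact ((functorOf F).map h) (app ys)

variable (κ) in
/-- The objects, arrows and 2-cells of `Cat_κ`. -/
abbrev catGraph : VDGraph.{u + 2, u + 1, u + 1, u + 2} where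
  Obj := LocSmallCat κ
  Hor := Prof
  Cell := ProfCell

/-- Cut a string of elements in two. -/
def Elts.split : {C D E : LocSmallCat κ} → (p : HPath (Prof (κ := κ)) C D) →
    {q : HPath (Prof (κ := κ)) D E} → {c : C.carrier} → {e : E.carrier} →
    Elts (p.append q) c e → Σ d : D.carrier, Elts p c d × Elts q d e
  | _, _, _, .nil _, _, c, _, xs => ⟨c, .nil c, xs⟩
  | _, _, _, .cons R p, q, c, e, xs =>
      match (show Elts (.cons R (p.append q)) c e from xs) with
      | .cons x xs =>
        let s := split p xs
        ⟨s.1, .cons x s.2.1, s.2.2⟩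

theorem EltsHom.split {C D E : LocSmallCat κ} (p : HPath (Prof (κ := κ)) C D)
    {q : HPath (Prof (κ := κ)) D E} {c c' : C.carrier} {e e' : E.carrier}
    {xs : Elts (p.append q) c e} {ys : Elts (p.append q) c' e'} {h : c ⟶ c'}
    {l : e ⟶ e'} (t : EltsHom xs ys h l) :
    ∃ k : (Elts.split p xs).1 ⟶ (Elts.split p ys).1,
      EltsHom (Elts.split p xs).2.1 (Elts.split p ys).2.1 h k ∧
      EltsHom (Elts.split p xs).2.2 (Elts.split p ys).2.2 k l := by
  induction p with
  | nil => exact ⟨h, .nil h, t⟩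
  | cons R p ih =>
    change @EltsHom κ _ _ (.cons R (p.append q)) _ _ _ _ xs ys h l at t
    cases t with
    | cons sq t =>
      obtain ⟨k, h₁, h₂⟩ := ih t
      exact ⟨k, .cons sq h₁, h₂⟩

/-- Apply the 2-cells of a row to the corresponding parts of a string of elements. -/
def rowApp : {A B A' B' : (catGraph κ).Obj} → {p : HPath (catGraph κ).Hor A B} →
    {q : HPath (catGraph κ).Hor A' B'} → {F : A ⟶ A'} → {G : B ⟶ B'} →
    Row (catGraph κ) p q F G → {c : LocSmallCat.carrier A} → {d : LocSmallCat.carrier B} →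
    Elts p c d →
    Elts q ((functorOf F).obj c) ((functorOf G).obj d)
  | _, _, _, _, _, _, _, _, .nil F, _, _, .nil c => .nil ((functorOf F).obj c)
  | _, _, _, _, _, _, _, _, .cons (p := p) φ ρ e, _, _, xs =>
      let s := Elts.split p (e ▸ xs)
      .cons (ProfCell.app φ s.2.1) (rowApp ρ s.2.2)

theorem rowApp_hom {A B A' B' : (catGraph κ).Obj} {p : HPath (catGraph κ).Hor A B}
    {q : HPath (catGraph κ).Hor A' B'} {F : A ⟶ A'} {G : B ⟶ B'}
    (ρ : Row (catGraph κ) p q F G) {c c' : LocSmallCat.carrier A} {d d' : LocSmallCat.carrier B}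
    {xs : Elts p c d} {ys : Elts p c' d'} {h : c ⟶ c'} {k : d ⟶ d'} (t : EltsHom xs ys h k) :
    EltsHom (rowApp ρ xs) (rowApp ρ ys) ((functorOf F).map h) ((functorOf G).map k) := by
  induction ρ with
  | nil F =>
    cases t with
    | nil h => exact .nil ((functorOf F).map h)
  | cons φ ρ e ih =>
    subst e
    obtain ⟨m, h₁, h₂⟩ := EltsHom.split _ t
    exact .cons (ProfCell.natural φ h₁) (ih h₂)

/-- The identity morphism of a profunctor. -/
def profId {C D : LocSmallCat κ} (R : Prof C D) : ProfCell (.single R) R (𝟙 C) (𝟙 D) where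
  app := fun | .cons x (.nil _) => x
  natural := fun | .cons sq (.nil _) => sq

/-- Composition of morphisms of profunctors. -/
def profComp {A B A' B' A'' B'' : LocSmallCat κ} {p : HPath (Prof (κ := κ)) A B}
    {q : HPath (Prof (κ := κ)) A' B'} {T : Prof A'' B''} {F : A ⟶ A'} {G : B ⟶ B'}
    {H : A' ⟶ A''} {K : B' ⟶ B''} (ρ : Row (catGraph κ) p q F G) (φ : ProfCell q T H K) :
    ProfCell p T (F ≫ H) (G ≫ K) where
  app xs := φ.app (rowApp ρ xs)
  natural t := φ.natural (rowApp_hom ρ t)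

/-- The restriction of a profunctor along functors, given by composition. -/
def profRestr {A B A' B' : LocSmallCat κ} (F : A' ⟶ A) (G : B' ⟶ B) (R : Prof A B) :
    Prof A' B' :=
  (functorOf F).op.prod (functorOf G) ⋙ R

/-- The morphism of profunctors `R(F, G) ⇒ R` framed by `F` and `G` that is the identity on
elements. -/
def profRestrCell {A B A' B' : LocSmallCat κ} (F : A' ⟶ A) (G : B' ⟶ B) (R : Prof A B) :
    ProfCell (.single (profRestr F G R)) R F G where
  app := fun | .cons x (.nil _) => x
  natural := fun
    | .cons (x := x) (y := y) (h := h) (k := k) sq (.nil _) => by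
      have e₁ : (profRestr F G R).ract k x = R.ract ((functorOf G).map k) x := by
        simp [Prof.ract, profRestr]
        rfl
      have e₂ : (profRestr F G R).lact h y = R.lact ((functorOf F).map h) y := by
        simp [Prof.lact, profRestr]
        rfl
      exact (e₁.symm.trans sq).trans e₂

end

/-- The data of the virtual double category `Cat_κ`: locally `κ`-small categories, functors,
profunctors valued in sets of cardinality less than `κ`, and morphisms of profunctors. -/
abbrev catVDC (κ : Cardinal.{u}) : PreVDC.{u + 2, u + 1, u + 1, u + 2} where
  toVDGraph := catGraph κ
  idCell := profId
  comp := profComp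

/-- The restrictions of profunctors in `Cat_κ`, given by composition of functors. -/
abbrev catRestrictions (κ : Cardinal.{u}) : (catVDC κ).Restrictions where
  restr := profRestr
  cell := profRestrCell

end VETT

/-!
The virtual double category laws, split fibrancy and all connectives of `Cat_κ` are verified on
elements.

A 2-cell out of a string `R₁, …, Rₙ` is a function on strings of elements of the `Rᵢ`, and
composing it with a row of 2-cells is precomposition with `rowApp`. Hence associativity and
unitality of composition say that `rowApp` takes vertical composition of rows to composition
(`rowApp_rowComp`) and identity rows to identities (`rowApp_idRow`). Both reduce to cutting
strings of elements along a concatenation. Since reassociating strings changes their type, such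
comparisons are heterogeneous equalities. The restriction 2-cells are the identity on elements,
so they are cartesian, and restriction is composition of functors, so it is strictly functorial.

For the set connectives, the values are computed as usual: homs `C(c, d)` for the unit, coends
`∫ᵈ P(c, d) × Q(d, e)` for tensors, sets of natural families for homs, and pointwise products.
When `D` has fewer than `κ` morphisms, regularity of `κ` bounds the coends (as quotients of
disjoint unions), and the strong limit property bounds the sets of natural families
(`hasCardinalLT_pi_fun`: such a family is determined by its graph). These sets live in a larger
universe and are replaced by small models. To have them commute with restriction strictly, and not
only up to isomorphism, profunctors are presented by their two one-sided actions (`ProfData`):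
the constructions are expressed by the actions alone, so that the two sides agree definitionally
once the actions of a restriction are computed (`data_profRestr`).

The universal properties with side strings `p` and `q` follow from
`bijective_comp_idRow_cons_idRow`. For the unit this is the Yoneda lemma in several variables
(`unitCell_universal`), where a morphism in the middle of a string is absorbed by the string to
its right (`Elts.pull`). For the tensor it is the universal property of the coend (`tensorLift`).

For the category connectives, the tabulator is the category of elements, and the presheaf objects
are `[Cᵒᵖ, κSet]` and `[C, κSet]ᵒᵖ`, again with small models of their hom-sets. The bijections are
currying, which is strict.
-/

namespace VETT

variable {κ : Cardinal.{u}}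

/-! ### Strings of elements and the action of rows on them -/

namespace Elts

/-- Concatenation of strings of elements. -/
def append : {C D E : LocSmallCat κ} → {p : HPath (Prof (κ := κ)) C D} →
    {q : HPath (Prof (κ := κ)) D E} → {c : C.carrier} → {d : D.carrier} → {e : E.carrier} →
    Elts p c d → Elts q d e → Elts (p.append q) c e
  | _, _, _, _, _, _, _, _, .nil _, ys => ys
  | _, _, _, _, _, _, _, _, .cons x xs, ys => .cons x (append xs ys)

variable {C D E : LocSmallCat κ} {p : HPath (Prof (κ := κ)) C D}
  {q : HPath (Prof (κ := κ)) D E} {c : C.carrier} {d : D.carrier} {e : E.carrier}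

theorem split_append (xs : Elts p c d) (ys : Elts q d e) :
    Elts.split p (xs.append ys) = ⟨d, xs, ys⟩ := by
  induction xs with
  | nil c => rfl
  | cons x xs ih =>
    have h := ih ys
    change (⟨_, .cons x (Elts.split _ (xs.append ys)).2.1,
      (Elts.split _ (xs.append ys)).2.2⟩ : Σ d, Elts _ _ d × Elts _ d _) = _
    rw [h]

/-- Every string of elements of a concatenation is a concatenation. -/
theorem exists_eq_append (p : HPath (Prof (κ := κ)) C D) (zs : Elts (p.append q) c e) :
    ∃ (d : D.carrier) (xs : Elts p c d) (ys : Elts q d e), zs = xs.append ys := by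
  induction p with
  | nil => exact ⟨c, .nil c, zs, rfl⟩
  | cons R p ih =>
    change @Elts κ _ _ (.cons R (p.append q)) c e at zs
    cases zs with
    | cons x zs =>
      obtain ⟨d, xs, ys, rfl⟩ := ih zs
      exact ⟨d, .cons x xs, ys, rfl⟩

theorem cons_heq {R : Prof C D} {q' : HPath (Prof (κ := κ)) D E} (h : q = q') (x : R.El c d)
    {xs : Elts q d e} {ys : Elts q' d e} (hxs : xs ≍ ys) :
    Elts.cons x xs ≍ Elts.cons x ys := by
  subst h; cases hxs; rfl

theorem append_heq {q' : HPath (Prof (κ := κ)) D E} (h : q = q') (xs : Elts p c d)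
    {ys : Elts q d e} {zs : Elts q' d e} (hys : ys ≍ zs) : xs.append ys ≍ xs.append zs := by
  subst h; cases hys; rfl

/-- The two sides have different types, since `p.append (.nil D) = p` is not definitional. -/
theorem append_nil_heq (xs : Elts p c d) : xs.append (.nil d) ≍ xs := by
  induction xs with
  | nil c => rfl
  | cons x xs ih => exact cons_heq (HPath.append_nil _) x ih

theorem append_assoc_heq {X : LocSmallCat κ} {r : HPath (Prof (κ := κ)) E X} {x : X.carrier}
    (xs : Elts p c d) (ys : Elts q d e) (zs : Elts r e x) :
    (xs.append ys).append zs ≍ xs.append (ys.append zs) := by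
  induction xs with
  | nil c => rfl
  | cons x xs ih => exact cons_heq (HPath.append_assoc _ _ _) x (ih ys)

theorem exists_heq {p' : HPath (Prof (κ := κ)) C D} (h : p = p') (xs : Elts p' c d) :
    ∃ ys : Elts p c d, ys ≍ xs := by
  subst h; exact ⟨xs, HEq.rfl⟩

end Elts

namespace EltsHom

variable {C D E : LocSmallCat κ} {p : HPath (Prof (κ := κ)) C D}
  {q : HPath (Prof (κ := κ)) D E} {c c' : C.carrier} {d d' : D.carrier} {e e' : E.carrier}

theorem append {xs : Elts p c d} {xs' : Elts p c' d'} {ys : Elts q d e} {ys' : Elts q d' e'}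
    {h : c ⟶ c'} {k : d ⟶ d'} {l : e ⟶ e'} (s : EltsHom xs xs' h k) (t : EltsHom ys ys' k l) :
    EltsHom (xs.append ys) (xs'.append ys') h l := by
  induction s with
  | nil h => exact t
  | cons sq s ih => exact .cons sq (ih t)

theorem of_append {xs : Elts p c d} {xs' : Elts p c' d'} {ys : Elts q d e}
    {ys' : Elts q d' e'} {h : c ⟶ c'} {l : e ⟶ e'}
    (t : EltsHom (xs.append ys) (xs'.append ys') h l) :
    ∃ k : d ⟶ d', EltsHom xs xs' h k ∧ EltsHom ys ys' k l := by
  have := EltsHom.split p t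
  rwa [Elts.split_append, Elts.split_append] at this

end EltsHom

namespace Prof

variable {C D : LocSmallCat κ} (R : Prof C D)

@[simp]
theorem lact_id {c : C.carrier} {d : D.carrier} (x : R.El c d) : R.lact (𝟙 c) x = x := by
  have h : R.map (Prod.mkHom (𝟙 (op c)) (𝟙 d)) = 𝟙 _ := R.map_id (op c, d)
  change (R.map (Prod.mkHom (𝟙 (op c)) (𝟙 d))).hom x = x
  rw [h]; rfl

@[simp]
theorem ract_id {c : C.carrier} {d : D.carrier} (x : R.El c d) : R.ract (𝟙 d) x = x :=
  R.lact_id x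

theorem map_apply {c c' : C.carrier} {d d' : D.carrier} (h : c ⟶ c') (k : d ⟶ d')
    (x : R.El c' d) : (R.map (Prod.mkHom h.op k)).hom x = R.lact h (R.ract k x) := by
  have e : (Prod.mkHom h.op k : (op c', d) ⟶ (op c, d')) =
      Prod.mkHom (𝟙 (op c')) k ≫ Prod.mkHom h.op (𝟙 d') := by
    ext <;> simp
  rw [e, R.map_comp]; rfl

theorem lact_ract {c c' : C.carrier} {d d' : D.carrier} (h : c ⟶ c') (k : d ⟶ d')
    (x : R.El c' d) : R.lact h (R.ract k x) = R.ract k (R.lact h x) := by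
  have e : (Prod.mkHom h.op k : (op c', d) ⟶ (op c, d')) =
      Prod.mkHom h.op (𝟙 d) ≫ Prod.mkHom (𝟙 (op c)) k := by
    ext <;> simp
  rw [← R.map_apply, e, R.map_comp]; rfl

theorem lact_comp {c c' c'' : C.carrier} {d : D.carrier} (h : c ⟶ c') (h' : c' ⟶ c'')
    (x : R.El c'' d) : R.lact (h ≫ h') x = R.lact h (R.lact h' x) := by
  have e : (Prod.mkHom (h ≫ h').op (𝟙 d) : (op c'', d) ⟶ (op c, d)) =
      Prod.mkHom h'.op (𝟙 d) ≫ Prod.mkHom h.op (𝟙 d) := by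
    ext <;> simp
  unfold lact
  rw [e, R.map_comp]; rfl

theorem ract_comp {c : C.carrier} {d d' d'' : D.carrier} (k : d ⟶ d') (k' : d' ⟶ d'')
    (x : R.El c d) : R.ract (k ≫ k') x = R.ract k' (R.ract k x) := by
  have e : (Prod.mkHom (𝟙 (op c)) (k ≫ k') : (op c, d) ⟶ (op c, d'')) =
      Prod.mkHom (𝟙 (op c)) k ≫ Prod.mkHom (𝟙 (op c)) k' := by
    ext <;> simp
  unfold ract
  rw [e, R.map_comp]; rfl

end Prof

theorem EltsHom.refl {C D : LocSmallCat κ} {p : HPath (Prof (κ := κ)) C D} {c : C.carrier}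
    {d : D.carrier} (xs : Elts p c d) : EltsHom xs xs (𝟙 c) (𝟙 d) := by
  induction xs with
  | nil c => exact .nil _
  | cons x xs ih => exact .cons (by simp) ih

section rowApp

variable {A B C A' B' C' : (catGraph κ).Obj} {p : HPath (catGraph κ).Hor A B}
  {q : HPath (catGraph κ).Hor B C} {p' : HPath (catGraph κ).Hor A' B'}
  {q' : HPath (catGraph κ).Hor B' C'} {F : A ⟶ A'} {G : B ⟶ B'} {H : C ⟶ C'}
  {a : LocSmallCat.carrier A} {b : LocSmallCat.carrier B} {c : LocSmallCat.carrier C}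

/-- The first 2-cell of a row acts on an initial segment of a string of elements.  Heterogeneous
equality absorbs the cast along the decomposition `e` recorded by the row. -/
theorem rowApp_cons {S : (catGraph κ).Hor A' B'} (φ : (catGraph κ).Cell p S F G)
    (ρ : Row (catGraph κ) q q' G H) {r : HPath (catGraph κ).Hor A C} (e : r = p.append q)
    {zs : Elts r a c} {xs : Elts p a b} {ys : Elts q b c} (h : zs ≍ xs.append ys) :
    rowApp (.cons φ ρ e) zs = .cons (ProfCell.app φ xs) (rowApp ρ ys) := by
  subst e
  cases h
  change Elts.cons (ProfCell.app φ (Elts.split p (xs.append ys)).2.1)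
    (rowApp ρ (Elts.split p (xs.append ys)).2.2) = _
  rw [Elts.split_append]

theorem rowApp_single {S : (catGraph κ).Hor A' B'} (φ : (catGraph κ).Cell p S F G)
    (xs : Elts p a b) : rowApp (Row.single φ) xs = .cons (ProfCell.app φ xs) (.nil _) :=
  rowApp_cons φ (.nil G) _ xs.append_nil_heq.symm

theorem rowApp_append (ρ : Row (catGraph κ) p p' F G) (σ : Row (catGraph κ) q q' G H)
    (xs : Elts p a b) (ys : Elts q b c) :
    rowApp (ρ.append σ) (xs.append ys) = (rowApp ρ xs).append (rowApp σ ys) := by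
  induction ρ with
  | nil F => cases xs; rfl
  | cons φ ρ e ih =>
    subst e
    obtain ⟨m, xs, xs', rfl⟩ := Elts.exists_eq_append _ xs
    rw [rowApp_cons φ ρ rfl HEq.rfl]
    refine (rowApp_cons φ (ρ.append σ) _ (Elts.append_assoc_heq _ _ _)).trans ?_
    rw [ih]; rfl

theorem rowApp_idRow (xs : Elts p a b) : rowApp ((catVDC κ).idRow p) xs = xs := by
  induction p with
  | nil => cases xs; rfl
  | cons R p ih =>
    cases xs with
    | cons x xs =>
      refine (rowApp_cons (C := _) (xs := .cons x (.nil _)) (profId R) ((catVDC κ).idRow p) rfl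
        HEq.rfl).trans ?_
      rw [ih]; rfl

/-- A row over `q₁ ⋯ q₂` acts through the two rows into which it is cut. -/
theorem rowApp_split (q₁ : HPath (catGraph κ).Hor A' B') {r : HPath (catGraph κ).Hor A C}
    (α : Row (catGraph κ) r (q₁.append q') F H) {m : LocSmallCat.carrier (Row.split q₁ α).mid}
    {zs : Elts r a c} {xs : Elts (Row.split q₁ α).top₁ a m}
    {ys : Elts (Row.split q₁ α).top₂ m c} (h : zs ≍ xs.append ys) :
    rowApp α zs =
      (rowApp (Row.split q₁ α).row₁ xs).append (rowApp (Row.split q₁ α).row₂ ys) := by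
  induction q₁ generalizing A with
  | nil =>
    change Elts (.nil A) a m at xs
    cases xs
    cases h
    rfl
  | cons S q₁ ih =>
    change Row (catGraph κ) r (.cons S (q₁.append q')) F H at α
    cases α with
    | @cons _ X _ _ _ _ p _ _ G φ _ _ _ ρ _ e =>
      change Elts (p.append (Row.split q₁ ρ).top₁) a m at xs
      obtain ⟨x, xs, xs', rfl⟩ := Elts.exists_eq_append _ xs
      obtain ⟨ys', hys'⟩ := Elts.exists_heq (Row.split q₁ ρ).eq (xs'.append ys)
      refine (rowApp_cons φ ρ e ((h.trans (Elts.append_assoc_heq _ _ _)).trans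
        (Elts.append_heq (Row.split q₁ ρ).eq.symm xs hys'.symm))).trans ?_
      rw [ih ρ hys']
      exact congrArg (fun ws => Elts.append ws (rowApp (Row.split q₁ ρ).row₂ ys))
        (rowApp_cons φ (Row.split q₁ ρ).row₁ rfl (HEq.refl (xs.append xs'))).symm

theorem rowApp_rowComp {A'' B'' : (catGraph κ).Obj} {r : HPath (catGraph κ).Hor A'' B''}
    {K : A' ⟶ A''} {L : B' ⟶ B''} (α : Row (catGraph κ) p p' F G)
    (β : Row (catGraph κ) p' r K L) (xs : Elts p a b) :
    rowApp ((catVDC κ).rowComp α β) xs = rowApp β (rowApp α xs) := by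
  induction β generalizing A with
  | nil h =>
    cases α
    cases xs
    rfl
  | @cons _ _ _ _ _ _ q₁ _ _ _ φ _ _ _ ρ _ e ih =>
    subst e
    obtain ⟨zs, hzs⟩ := Elts.exists_heq (Row.split q₁ α).eq.symm xs
    obtain ⟨m, xs', ys, rfl⟩ := Elts.exists_eq_append _ zs
    rw [rowApp_split q₁ α hzs.symm, rowApp_cons φ ρ rfl HEq.rfl, ← ih]
    -- Not definitional, since `rowComp` also matches on `α`.
    have h : (catVDC κ).rowComp α (.cons φ ρ rfl) =
        .cons ((catVDC κ).comp (Row.split q₁ α).row₁ φ)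
          ((catVDC κ).rowComp (Row.split q₁ α).row₂ ρ) (Row.split q₁ α).eq := by
      rw [PreVDC.rowComp]
    rw [h]
    exact rowApp_cons ((catVDC κ).comp (Row.split q₁ α).row₁ φ)
      ((catVDC κ).rowComp (Row.split q₁ α).row₂ ρ) _ hzs.symm

/-- Substitution of one 2-cell into the middle of a string. -/
theorem rowApp_idRow_cons_idRow {A B C D : (catGraph κ).Obj} {p : HPath (catGraph κ).Hor A B}
    {r : HPath (catGraph κ).Hor B C} {q : HPath (catGraph κ).Hor C D}
    {R : (catGraph κ).Hor B C} (φ : (catGraph κ).Cell r R (𝟙 B) (𝟙 C))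
    {a : LocSmallCat.carrier A} {b : LocSmallCat.carrier B} {c : LocSmallCat.carrier C}
    {d : LocSmallCat.carrier D} (xs : Elts p a b) (ys : Elts r b c) (zs : Elts q c d) :
    rowApp (((catVDC κ).idRow p).append (.cons φ ((catVDC κ).idRow q) rfl))
      (xs.append (ys.append zs)) =
        xs.append (.cons (R := R) (ProfCell.app φ ys) zs) := by
  rw [rowApp_append, rowApp_cons φ _ rfl HEq.rfl, rowApp_idRow, rowApp_idRow]

end rowApp

/-! ### Composition of 2-cells and restrictions -/

theorem catVDC_isVirtualDoubleCategory (κ : Cardinal.{u}) :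
    (catVDC κ).IsVirtualDoubleCategory where
  id_comp {A B A' B' p S F G} φ := by
    change profComp ((catVDC κ).idRow p) φ = φ
    refine ProfCell.ext ?_
    funext c d xs
    change ProfCell.app φ (rowApp ((catVDC κ).idRow p) xs) = _
    rw [rowApp_idRow]
  comp_id {A B A' B' p S F G} φ := by
    change profComp (Row.single φ) (profId S) = φ
    refine ProfCell.ext ?_
    funext c d xs
    change (profId S).app (rowApp (Row.single φ) xs) = _
    rw [rowApp_single]
    rfl
  assoc {A B A' B' A'' B'' X Y p q r T F G H K L M} α β φ := by
    change profComp ((catVDC κ).rowComp α β) φ = profComp α (profComp β φ)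
    refine ProfCell.ext ?_
    funext c d xs
    change ProfCell.app φ (rowApp ((catVDC κ).rowComp α β) xs) =
      ProfCell.app φ (rowApp β (rowApp α xs))
    rw [rowApp_rowComp]

theorem profRestr_ract {A B A' B' : LocSmallCat κ} (F : A' ⟶ A) (G : B' ⟶ B) (R : Prof A B)
    {a : A'.carrier} {b b' : B'.carrier} (k : b ⟶ b') (x : (profRestr F G R).El a b) :
    (profRestr F G R).ract k x = R.ract ((functorOf G).map k) x := by
  simp [Prof.ract, profRestr]
  rfl

theorem profRestr_lact {A B A' B' : LocSmallCat κ} (F : A' ⟶ A) (G : B' ⟶ B) (R : Prof A B)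
    {a a' : A'.carrier} {b : B'.carrier} (h : a ⟶ a') (x : (profRestr F G R).El a' b) :
    (profRestr F G R).lact h x = R.lact ((functorOf F).map h) x := by
  simp [Prof.lact, profRestr]
  rfl

theorem catRestrictions_isSplitFibrant (κ : Cardinal.{u}) :
    (catRestrictions κ).IsSplitFibrant where
  cartesian {A B A' B' X Y} F G R p H K := by
    have key (φ : ProfCell p (profRestr F G R) H K) {c d} (xs : Elts p c d) :
        (profComp (Row.single (G := catGraph κ) φ) (profRestrCell F G R)).app xs = φ.app xs := by
      change (profRestrCell F G R).app (rowApp (Row.single (G := catGraph κ) φ) xs) = _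
      rw [rowApp_single]
      rfl
    constructor
    · intro φ ψ h
      refine ProfCell.ext ?_
      funext c d xs
      rw [← key φ, ← key ψ]
      exact congrArg (fun χ => ProfCell.app χ xs) h
    · intro ψ
      refine ⟨⟨fun xs => ψ.app xs, fun {_ _ _ _ xs ys h k} t => ?_⟩, ProfCell.ext ?_⟩
      · exact (profRestr_ract F G R ((functorOf K).map k) (ψ.app xs)).trans ((ψ.natural t).trans
          (profRestr_lact F G R ((functorOf H).map h) (ψ.app ys)).symm)
      · funext c d xs
        exact key _ xs
  restr_id R := rfl
  restr_comp _ _ _ _ _ := rfl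
  cell_id R := by
    refine heq_of_eq (ProfCell.ext ?_)
    funext c d xs
    cases xs with
    | cons x xs => cases xs; rfl
  cell_comp {_ _ _ _ A'' B''} F' F G' G R := by
    refine heq_of_eq (ProfCell.ext ?_)
    funext c d xs
    change _ = (profRestrCell F G R).app
      (rowApp (Row.single (G := catGraph κ) (profRestrCell F' G' (profRestr F G R))) xs)
    refine Eq.trans ?_ (congrArg (profRestrCell F G R).app (rowApp_single (A := A'') (B := B'')
      (profRestrCell F' G' (profRestr F G R)) xs).symm)
    cases xs with
    | cons x xs => cases xs; rfl

/-! ### Cardinality bounds -/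

theorem hasCardinalLT_set (hκ : κ.IsStrongLimit) {X : Type*}
    (hX : HasCardinalLT X κ) : HasCardinalLT (Set X) κ := by
  have : Small.{u} X := hX.small
  rw [hasCardinalLT_iff_of_equiv (Equiv.Set.congr (equivShrink.{u} X)),
    hasCardinalLT_iff_cardinal_mk_lt, Cardinal.mk_set]
  refine hκ.isStrongPrelimit ?_
  rwa [← hasCardinalLT_iff_cardinal_mk_lt, ← hasCardinalLT_iff_of_equiv (equivShrink.{u} X)]

/-- A family of functions is determined by its graph, a subset of a small disjoint union. -/
theorem hasCardinalLT_pi_fun (hκ : κ.IsRegular) (hκ' : κ.IsStrongLimit)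
    {ι : Type*} (hι : HasCardinalLT ι κ) {X Y : ι → Type*} (hX : ∀ i, HasCardinalLT (X i) κ)
    (hY : ∀ i, HasCardinalLT (Y i) κ) : HasCardinalLT (∀ i, X i → Y i) κ := by
  have : Fact κ.IsRegular := ⟨hκ⟩
  refine (hasCardinalLT_set hκ' (hasCardinalLT_sigma (fun i => X i × Y i) κ hι fun i =>
    hasCardinalLT_prod hκ.aleph0_le (hX i) (hY i))).of_injective
      (fun α => {s | α s.1 s.2.1 = s.2.2}) ?_
  intro α β h
  funext i x
  have : (⟨i, x, α i x⟩ : Σ i, X i × Y i) ∈ {s | α s.1 s.2.1 = s.2.2} := rfl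
  exact (((Set.ext_iff.mp h) _).mp this).symm

theorem hasCardinalLT_carrier {D : LocSmallCat κ} (hD : D ∈ smallCats κ) :
    HasCardinalLT D.carrier κ :=
  HasCardinalLT.of_injective hD (fun d => Arrow.mk (𝟙 d))
    fun _ _ h => congrArg Arrow.leftFunc.obj h

theorem Prof.hasCardinalLT_el {C D : LocSmallCat κ} (R : Prof C D) (c : C.carrier)
    (d : D.carrier) : HasCardinalLT (R.El c d) κ :=
  (hasCardinalLT_iff_cardinal_mk_lt _ _).mpr (R.obj (op c, d)).property

/-! ### Profunctors given by their actions -/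

universe v

/-- A profunctor presented by its sets of elements and its two commuting actions.  The sets of
elements may live in any universe, but have cardinality less than `κ`.  Unlike in `Prof`, the two
actions are primitive, so that a construction expressed through them commutes definitionally
with `ProfData.restr`. -/
structure ProfData (C D : LocSmallCat κ) where
  El : C.carrier → D.carrier → Type v
  card : ∀ c d, HasCardinalLT (El c d) κ
  lact : ∀ {c c' : C.carrier} {d : D.carrier}, (c ⟶ c') → El c' d → El c d
  ract : ∀ {c : C.carrier} {d d' : D.carrier}, (d ⟶ d') → El c d → El c d'
  lact_id : ∀ {c d} (x : El c d), lact (𝟙 c) x = x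
  ract_id : ∀ {c d} (x : El c d), ract (𝟙 d) x = x
  lact_comp : ∀ {c c' c'' d} (h : c ⟶ c') (h' : c' ⟶ c'') (x : El c'' d),
    lact (h ≫ h') x = lact h (lact h' x)
  ract_comp : ∀ {c d d' d''} (k : d ⟶ d') (k' : d' ⟶ d'') (x : El c d),
    ract (k ≫ k') x = ract k' (ract k x)
  lact_ract : ∀ {c c' d d'} (h : c ⟶ c') (k : d ⟶ d') (x : El c' d),
    lact h (ract k x) = ract k (lact h x)

/-- The sets of elements and the actions of a profunctor. -/
def Prof.data {C D : LocSmallCat κ} (R : Prof C D) : ProfData.{u, u} C D where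
  El := R.El
  card := R.hasCardinalLT_el
  lact h x := R.lact h x
  ract k x := R.ract k x
  lact_id := R.lact_id
  ract_id := R.ract_id
  lact_comp := R.lact_comp
  ract_comp := R.ract_comp
  lact_ract := R.lact_ract

namespace ProfData

variable {C D : LocSmallCat κ} (X : ProfData.{u, v} C D)

instance (c : C.carrier) (d : D.carrier) : Small.{u} (X.El c d) := (X.card c d).small

/-- Restriction along functors. -/
def restr {C' D' : LocSmallCat κ} (F : C' ⟶ C) (G : D' ⟶ D) (X : ProfData.{u, v} C D) :
    ProfData.{u, v} C' D' where
  El c d := X.El ((functorOf F).obj c) ((functorOf G).obj d)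
  card _ _ := X.card _ _
  lact h := X.lact ((functorOf F).map h)
  ract k := X.ract ((functorOf G).map k)
  lact_id x := by rw [CategoryTheory.Functor.map_id, X.lact_id]
  ract_id x := by rw [CategoryTheory.Functor.map_id, X.ract_id]
  lact_comp h h' x := by rw [CategoryTheory.Functor.map_comp, X.lact_comp]
  ract_comp k k' x := by rw [CategoryTheory.Functor.map_comp, X.ract_comp]
  lact_ract h k x := X.lact_ract _ _ x

/-- The profunctor with given actions, on small models of the sets of elements. -/
noncomputable def toProf : Prof C D where
  obj s := ⟨Shrink.{u} (X.El s.1.unop s.2), by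
    rw [← hasCardinalLT_iff_cardinal_mk_lt, ← hasCardinalLT_iff_of_equiv (equivShrink.{u} _)]
    exact X.card _ _⟩
  map f := ObjectProperty.homMk (TypeCat.ofHom fun x =>
    equivShrink _ (X.lact f.1.unop (X.ract f.2 ((equivShrink _).symm x))))
  map_id s := by
    ext x
    simp [X.ract_id, X.lact_id]
  map_comp f g := by
    ext x
    simp [X.ract_comp, X.lact_comp, X.lact_ract]

/-- The elements of `X.toProf` are those of `X`. -/
noncomputable def elEquiv (c : C.carrier) (d : D.carrier) : X.El c d ≃ X.toProf.El c d :=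
  equivShrink _

variable {X}

theorem toProf_lact {c c' : C.carrier} (h : c ⟶ c') {d : D.carrier} (x : X.El c' d) :
    X.toProf.lact h (X.elEquiv _ _ x) = X.elEquiv _ _ (X.lact h x) := by
  change equivShrink _ (X.lact h (X.ract (𝟙 _) ((equivShrink _).symm (equivShrink _ x)))) = _
  rw [Equiv.symm_apply_apply, X.ract_id]
  rfl

theorem toProf_ract {c : C.carrier} {d d' : D.carrier} (k : d ⟶ d') (x : X.El c d) :
    X.toProf.ract k (X.elEquiv _ _ x) = X.elEquiv _ _ (X.ract k x) := by
  change equivShrink _ (X.lact (𝟙 _) (X.ract k ((equivShrink _).symm (equivShrink _ x)))) = _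
  rw [Equiv.symm_apply_apply, X.lact_id]
  rfl

theorem elEquiv_symm_lact {c c' : C.carrier} (h : c ⟶ c') {d : D.carrier}
    (x : X.toProf.El c' d) :
    (X.elEquiv _ _).symm (X.toProf.lact h x) = X.lact h ((X.elEquiv _ _).symm x) := by
  rw [Equiv.symm_apply_eq, ← toProf_lact, Equiv.apply_symm_apply]

theorem elEquiv_symm_ract {c : C.carrier} {d d' : D.carrier} (k : d ⟶ d')
    (x : X.toProf.El c d) :
    (X.elEquiv _ _).symm (X.toProf.ract k x) = X.ract k ((X.elEquiv _ _).symm x) := by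
  rw [Equiv.symm_apply_eq, ← toProf_ract, Equiv.apply_symm_apply]

end ProfData

/-- Functors preserve identities only propositionally, so the one-sided actions of a restriction
are computed by `profRestr_lact` and `profRestr_ract` and not by reduction. -/
theorem data_profRestr {C D C' D' : LocSmallCat κ} (F : C' ⟶ C) (G : D' ⟶ D) (R : Prof C D) :
    (profRestr F G R).data = R.data.restr F G := by
  have hl : (fun {_ _ _} h x => (profRestr F G R).lact h x : ∀ {c c' d}, (c ⟶ c') →
      (profRestr F G R).El c' d → (profRestr F G R).El c d) =
        fun {_ _ _} h x => R.lact ((functorOf F).map h) x := by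
    funext c c' d h x
    exact profRestr_lact F G R h x
  have hr : (fun {_ _ _} k x => (profRestr F G R).ract k x : ∀ {c d d'}, (d ⟶ d') →
      (profRestr F G R).El c d → (profRestr F G R).El c d') =
        fun {_ _ _} k x => R.ract ((functorOf G).map k) x := by
    funext c d d' k x
    exact profRestr_ract F G R k x
  unfold Prof.data ProfData.restr
  simp only [ProfData.mk.injEq]
  exact ⟨rfl, heq_of_eq hl, heq_of_eq hr⟩

namespace ProfData

variable {B C D E : LocSmallCat κ}

/-- The hom profunctor. -/
def unit (C : LocSmallCat κ) : ProfData.{u, u} C C where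
  El c d := c ⟶ d
  card c d := (hasCardinalLT_iff_cardinal_mk_lt _ _).mpr (C.hom_lt c d)
  lact h x := h ≫ x
  ract k x := x ≫ k
  lact_id := by simp
  ract_id := by simp
  lact_comp := by simp
  ract_comp := by simp
  lact_ract := by simp

/-- The terminal profunctor. -/
def top (hκ : κ.IsRegular) (C D : LocSmallCat κ) : ProfData.{u, 0} C D where
  El _ _ := PUnit
  card _ _ := hasCardinalLT_of_finite _ _ hκ.aleph0_le
  lact _ _ := ⟨⟩
  ract _ _ := ⟨⟩
  lact_id _ := rfl
  ract_id _ := rfl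
  lact_comp _ _ _ := rfl
  ract_comp _ _ _ := rfl
  lact_ract _ _ _ := rfl

/-- The pointwise product of profunctors. -/
def times (hκ : κ.IsRegular) (P Q : ProfData.{u, u} C D) : ProfData.{u, u} C D where
  El c d := P.El c d × Q.El c d
  card c d := hasCardinalLT_prod hκ.aleph0_le (P.card c d) (Q.card c d)
  lact h x := (P.lact h x.1, Q.lact h x.2)
  ract k x := (P.ract k x.1, Q.ract k x.2)
  lact_id x := by rw [P.lact_id, Q.lact_id]
  ract_id x := by rw [P.ract_id, Q.ract_id]
  lact_comp h h' x := by rw [P.lact_comp, Q.lact_comp]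
  ract_comp k k' x := by rw [P.ract_comp, Q.ract_comp]
  lact_ract h k x := by rw [P.lact_ract, Q.lact_ract]

/-- The relation generating the coend `∫ᵈ P(c, d) × Q(d, e)`. It is a definition rather than an
inductive type in order to commute definitionally with restriction. -/
def TensorRel (P : ProfData.{u, u} C D) (Q : ProfData.{u, u} D E) (c : C.carrier)
    (e : E.carrier) (s t : Σ d, P.El c d × Q.El d e) : Prop :=
  ∃ k : t.1 ⟶ s.1, s.2.1 = P.ract k t.2.1 ∧ t.2.2 = Q.lact k s.2.2

/-- The tensor of two profunctors, whose elements form the coend `∫ᵈ P(c, d) × Q(d, e)`. -/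
def tensor (hκ : κ.IsRegular) (hD : D ∈ smallCats κ) (P : ProfData.{u, u} C D)
    (Q : ProfData.{u, u} D E) : ProfData.{u, u + 1} C E where
  El c e := Quot (TensorRel P Q c e)
  card c e := by
    have : Fact κ.IsRegular := ⟨hκ⟩
    exact (hasCardinalLT_sigma (fun d => P.El c d × Q.El d e) κ (hasCardinalLT_carrier hD)
      fun d => hasCardinalLT_prod hκ.aleph0_le (P.card c d) (Q.card d e)).of_surjective _
        Quot.mk_surjective
  lact h := Quot.map (fun s => ⟨s.1, P.lact h s.2.1, s.2.2⟩) (by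
    rintro ⟨d, x, y⟩ ⟨d', x', y'⟩ ⟨k, hx, hy⟩
    refine ⟨k, ?_, hy⟩
    dsimp only at hx ⊢
    rw [hx, P.lact_ract])
  ract l := Quot.map (fun s => ⟨s.1, s.2.1, Q.ract l s.2.2⟩) (by
    rintro ⟨d, x, y⟩ ⟨d', x', y'⟩ ⟨k, hx, hy⟩
    refine ⟨k, hx, ?_⟩
    dsimp only at hy ⊢
    rw [hy, Q.lact_ract])
  lact_id := by rintro c e ⟨s⟩; simp only [Quot.map, P.lact_id]
  ract_id := by rintro c e ⟨s⟩; simp only [Quot.map, Q.ract_id]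
  lact_comp := by rintro c c' c'' e h h' ⟨s⟩; simp only [Quot.map, P.lact_comp]
  ract_comp := by rintro c e e' e'' k k' ⟨s⟩; simp only [Quot.map, Q.ract_comp]
  lact_ract := by rintro c c' e e' h k ⟨s⟩; rfl

/-- The covariant hom of two profunctors, whose elements over `c` and `b` are the natural
families of maps `P(b, d) → Q(c, d)`. -/
def covHom (hκ : κ.IsRegular) (hκ' : κ.IsStrongLimit) (hD : D ∈ smallCats κ)
    (P : ProfData.{u, u} B D) (Q : ProfData.{u, u} C D) : ProfData.{u, u + 1} C B where
  El c b := {α : ∀ d, P.El b d → Q.El c d //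
    ∀ (d d' : D.carrier) (k : d ⟶ d') x, α d' (P.ract k x) = Q.ract k (α d x)}
  card c b := (hasCardinalLT_pi_fun hκ hκ' (hasCardinalLT_carrier hD) (fun d => P.card b d)
    (fun d => Q.card c d)).of_injective _ Subtype.val_injective
  lact h α := ⟨fun d x => Q.lact h (α.1 d x), fun d d' k x => by
    dsimp only
    rw [α.2, Q.lact_ract]⟩
  ract k α := ⟨fun d x => α.1 d (P.lact k x), fun d d' l x => by
    dsimp only
    rw [P.lact_ract, α.2]⟩
  lact_id α := by simp only [Q.lact_id]
  ract_id α := by simp only [P.lact_id]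
  lact_comp h h' α := by simp only [Q.lact_comp]
  ract_comp k k' α := by simp only [P.lact_comp]
  lact_ract h k α := rfl

/-- The contravariant hom of two profunctors, whose elements over `b` and `c` are the natural
families of maps `Q(d, b) → P(d, c)`. -/
def contraHom (hκ : κ.IsRegular) (hκ' : κ.IsStrongLimit) (hD : D ∈ smallCats κ)
    (P : ProfData.{u, u} D C) (Q : ProfData.{u, u} D B) : ProfData.{u, u + 1} B C where
  El b c := {α : ∀ d, Q.El d b → P.El d c //
    ∀ (d d' : D.carrier) (k : d ⟶ d') x, α d (Q.lact k x) = P.lact k (α d' x)}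
  card b c := (hasCardinalLT_pi_fun hκ hκ' (hasCardinalLT_carrier hD) (fun d => Q.card d b)
    (fun d => P.card d c)).of_injective _ Subtype.val_injective
  lact h α := ⟨fun d x => α.1 d (Q.ract h x), fun d d' k x => by
    dsimp only
    rw [← Q.lact_ract, α.2]⟩
  ract k α := ⟨fun d x => P.ract k (α.1 d x), fun d d' l x => by
    dsimp only
    rw [α.2, P.lact_ract]⟩
  lact_id α := by simp only [Q.ract_id]
  ract_id α := by simp only [P.ract_id]
  lact_comp h h' α := by simp only [Q.ract_comp]
  ract_comp k k' α := by simp only [P.ract_comp]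
  lact_ract h k α := rfl

end ProfData

/-! ### Universal 2-cells in the middle of a string -/

section Universal

variable {A B C E A' B' : LocSmallCat κ} {p : HPath (Prof (κ := κ)) A C}
  {q : HPath (Prof (κ := κ)) E B} {T : Prof C E} {S : Prof A' B'} {F : A ⟶ A'} {G : B ⟶ B'}

theorem ProfCell.ext_append_cons {φ ψ : ProfCell (p.append (.cons T q)) S F G}
    (h : ∀ {a c e b} (xs : Elts p a c) (t : T.El c e) (ys : Elts q e b),
      φ.app (xs.append (.cons t ys)) = ψ.app (xs.append (.cons t ys))) : φ = ψ := by
  refine ProfCell.ext ?_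
  funext a b zs
  obtain ⟨c, xs, ys, rfl⟩ := Elts.exists_eq_append p zs
  cases ys with
  | cons t ys => exact h xs t ys

/-- A 2-cell out of `p, T, q` may be given by its values on concatenations. -/
theorem ProfCell.exists_of_append_cons
    (f : ∀ {a c e b}, Elts p a c → T.El c e → Elts q e b →
      S.El ((functorOf F).obj a) ((functorOf G).obj b))
    (hf : ∀ {a c e b a' c' e' b'} {xs : Elts p a c} {t : T.El c e} {ys : Elts q e b}
      {xs' : Elts p a' c'} {t' : T.El c' e'} {ys' : Elts q e' b'} {h : a ⟶ a'} {k : c ⟶ c'}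
      {l : e ⟶ e'} {m : b ⟶ b'}, EltsHom xs xs' h k → T.ract l t = T.lact k t' →
      EltsHom ys ys' l m → S.ract ((functorOf G).map m) (f xs t ys) =
        S.lact ((functorOf F).map h) (f xs' t' ys')) :
    ∃ φ : ProfCell (p.append (.cons T q)) S F G,
      ∀ {a c e b} (xs : Elts p a c) (t : T.El c e) (ys : Elts q e b),
        φ.app (xs.append (.cons t ys)) = f xs t ys := by
  let f' {a b} (s : Σ c, Elts p a c × Elts (.cons T q) c b) :
      S.El ((functorOf F).obj a) ((functorOf G).obj b) :=
    match s with
    | ⟨_, xs, .cons t ys⟩ => f xs t ys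
  have hf' {a c e b} (xs : Elts p a c) (t : T.El c e) (ys : Elts q e b) :
      f' (Elts.split p (xs.append (.cons t ys))) = f xs t ys := by
    rw [Elts.split_append]
    rfl
  refine ⟨⟨fun zs => f' (Elts.split p zs), ?_⟩, hf'⟩
  intro a a' b b' zs zs' h m t
  obtain ⟨c, xs, ys, rfl⟩ := Elts.exists_eq_append p zs
  obtain ⟨c', xs', ys', rfl⟩ := Elts.exists_eq_append p zs'
  obtain ⟨k, h₁, h₂⟩ := t.of_append
  cases h₂ with
  | cons sq h₂ =>
    rw [hf', hf']
    exact hf h₁ sq h₂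

/-- A 2-cell `r ⇒ T` is universal if every 2-cell out of `p, T, q` is determined by its values on
the image of `r`, where they may be prescribed. -/
theorem bijective_comp_idRow_cons_idRow {r : HPath (Prof (κ := κ)) C E}
    (cell : ProfCell r T (𝟙 C) (𝟙 E))
    (inj : ∀ {φ φ' : ProfCell (p.append (.cons T q)) S F G},
      (∀ {a c e b} (xs : Elts p a c) (ys : Elts r c e) (zs : Elts q e b),
        φ.app (xs.append (.cons (R := T) (cell.app ys) zs)) =
          φ'.app (xs.append (.cons (R := T) (cell.app ys) zs))) → φ = φ')
    (surj : ∀ ψ : ProfCell (p.append (r.append q)) S F G,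
      ∃ φ : ProfCell (p.append (.cons T q)) S F G,
        ∀ {a c e b} (xs : Elts p a c) (ys : Elts r c e) (zs : Elts q e b),
          φ.app (xs.append (.cons (R := T) (cell.app ys) zs)) =
            ψ.app (xs.append (ys.append zs))) :
    Function.Bijective (fun φ : ProfCell (p.append (.cons T q)) S F G =>
      (profComp (((catVDC κ).idRow p).append (.cons cell ((catVDC κ).idRow q) rfl)) φ :
        ProfCell (p.append (r.append q)) S (𝟙 A ≫ F) (𝟙 B ≫ G))) := by
  have key (φ : ProfCell (p.append (.cons T q)) S F G) {a c e b} (xs : Elts p a c)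
      (ys : Elts r c e) (zs : Elts q e b) :
      (profComp (((catVDC κ).idRow p).append (.cons cell ((catVDC κ).idRow q) rfl)) φ).app
        (xs.append (ys.append zs)) = φ.app (xs.append (.cons (R := T) (cell.app ys) zs)) :=
    congrArg φ.app (rowApp_idRow_cons_idRow cell xs ys zs)
  constructor
  · intro φ φ' h
    refine inj fun xs ys zs => ?_
    rw [← key, ← key]
    exact congrArg (fun χ => ProfCell.app χ (xs.append (ys.append zs))) h
  · intro ψ
    obtain ⟨φ, hφ⟩ := surj ψ
    refine ⟨φ, ProfCell.ext ?_⟩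
    funext a b zs
    obtain ⟨c, xs, ys, rfl⟩ := Elts.exists_eq_append p zs
    obtain ⟨e, ys, zs, rfl⟩ := Elts.exists_eq_append r ys
    exact (key φ xs ys zs).trans (hφ xs ys zs)

end Universal

/-! ### Units -/

/-- The action of a morphism `u : c ⟶ c'` on a string of elements starting at `c'`: it acts on
the first element.  The empty string at `c'` is replaced by that at `c`, and its end point moves
along `u`, so that the result comes with a morphism between the end points. -/
def Elts.pull : {D E : LocSmallCat κ} → {q : HPath (Prof (κ := κ)) D E} → {c c' : D.carrier} →
    {e : E.carrier} → Elts q c' e → (c ⟶ c') → Σ e' : E.carrier, Elts q c e' × (e' ⟶ e)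
  | _, _, _, c, _, _, .nil _, u => ⟨c, .nil c, u⟩
  | _, _, _, _, _, e, .cons (R := R) x xs, u => ⟨e, .cons (R.lact u x) xs, 𝟙 e⟩

theorem Elts.pull_hom {D E : LocSmallCat κ} {q : HPath (Prof (κ := κ)) D E} {c c' : D.carrier}
    {e : E.carrier} (xs : Elts q c' e) (u : c ⟶ c') :
    EltsHom (xs.pull u).2.1 xs u (xs.pull u).2.2 := by
  cases xs with
  | nil => exact .nil u
  | cons x xs => exact .cons (Prof.ract_id _ _) (.refl xs)

/-- The morphism between end points that accompanies `Elts.pull` is compatible with morphisms of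
strings. -/
theorem Elts.pull_natural {D E : LocSmallCat κ} {q : HPath (Prof (κ := κ)) D E}
    {c₁ c₁' c₂ c₂' : D.carrier} {e₁ e₂ : E.carrier} {xs₁ : Elts q c₁' e₁}
    {xs₂ : Elts q c₂' e₂} {k' : c₁' ⟶ c₂'} {l : e₁ ⟶ e₂} (t : EltsHom xs₁ xs₂ k' l)
    {u₁ : c₁ ⟶ c₁'} {u₂ : c₂ ⟶ c₂'} {k : c₁ ⟶ c₂} (h : u₁ ≫ k' = k ≫ u₂) :
    ∃ l' : (xs₁.pull u₁).1 ⟶ (xs₂.pull u₂).1,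
      EltsHom (xs₁.pull u₁).2.1 (xs₂.pull u₂).2.1 k l' ∧
        (xs₁.pull u₁).2.2 ≫ l = l' ≫ (xs₂.pull u₂).2.2 := by
  cases t with
  | nil => exact ⟨k, .nil k, h⟩
  | @cons _ _ _ R _ _ _ _ _ _ _ x y _ _ _ m _ sq t =>
    refine ⟨l, .cons ?_ t, (Category.id_comp l).trans (Category.comp_id l).symm⟩
    rw [← Prof.lact_ract, sq, ← Prof.lact_comp, ← Prof.lact_comp, h]

/-- The elements of the hom profunctor are the morphisms. -/
noncomputable def homEquiv {C : LocSmallCat κ} (c d : C.carrier) :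
    (c ⟶ d) ≃ (ProfData.unit C).toProf.El c d :=
  (ProfData.unit C).elEquiv c d

theorem homEquiv_symm_lact {C : LocSmallCat κ} {c c' d : C.carrier} (h : c ⟶ c')
    (t : (ProfData.unit C).toProf.El c' d) :
    (homEquiv c d).symm (Prof.lact _ h t) = h ≫ (homEquiv c' d).symm t :=
  ProfData.elEquiv_symm_lact h t

theorem homEquiv_symm_ract {C : LocSmallCat κ} {c d d' : C.carrier} (k : d ⟶ d')
    (t : (ProfData.unit C).toProf.El c d) :
    (homEquiv c d').symm (Prof.ract _ k t) = (homEquiv c d).symm t ≫ k :=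
  ProfData.elEquiv_symm_ract k t

theorem ract_homEquiv_id {C : LocSmallCat κ} {c c' : C.carrier} (u : c ⟶ c') :
    Prof.ract _ u (homEquiv c c (𝟙 c)) = homEquiv c c' u := by
  rw [← Equiv.symm_apply_eq, homEquiv_symm_ract, Equiv.symm_apply_apply, Category.id_comp]

theorem lact_homEquiv_id {C : LocSmallCat κ} {c c' : C.carrier} (u : c ⟶ c') :
    Prof.lact _ u (homEquiv c' c' (𝟙 c')) = homEquiv c c' u := by
  rw [← Equiv.symm_apply_eq, homEquiv_symm_lact, Equiv.symm_apply_apply, Category.comp_id]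

/-- The identity elements of the hom profunctor. -/
noncomputable def unitCell (C : LocSmallCat κ) :
    ProfCell (.nil C) (ProfData.unit C).toProf (𝟙 C) (𝟙 C) where
  app := fun | .nil c => homEquiv c c (𝟙 c)
  natural := fun | .nil h => (ract_homEquiv_id h).trans (lact_homEquiv_id h).symm

/-- The universal property of the unit is an instance of the Yoneda lemma: a 2-cell is extended
from the identities to a morphism `u` by letting `u` act on the string to its right. -/
theorem unitCell_universal {A B C A' B' : LocSmallCat κ} (p : HPath (Prof (κ := κ)) A C)
    (q : HPath (Prof (κ := κ)) C B) (S : Prof A' B') (F : A ⟶ A') (G : B ⟶ B') :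
    Function.Bijective (fun φ : ProfCell (p.append (.cons (ProfData.unit C).toProf q)) S F G =>
      (profComp (((catVDC κ).idRow p).append (.cons (unitCell C) ((catVDC κ).idRow q) rfl)) φ :
        ProfCell (p.append q) S (𝟙 A ≫ F) (𝟙 B ≫ G))) := by
  refine bijective_comp_idRow_cons_idRow (unitCell C) ?_ ?_
  · intro φ φ' h
    refine ProfCell.ext_append_cons fun {a c c' b} xs t ys => ?_
    obtain ⟨u, rfl⟩ := (homEquiv c c').surjective t
    -- The pair `(u, ys)` receives a morphism of strings from `(𝟙 c, ys.pull u)`, so naturality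
    -- determines the value at `u` from a value at an identity.
    have key (χ : ProfCell (p.append (.cons (ProfData.unit C).toProf q)) S F G) :=
      χ.natural ((EltsHom.refl xs).append (.cons
        (x := homEquiv c c (𝟙 c)) (y := homEquiv c c' u) (by
          rw [ract_homEquiv_id, Prof.lact_id]) (Elts.pull_hom ys u)))
    simp only [CategoryTheory.Functor.map_id, Prof.lact_id] at key
    rw [← key φ, ← key φ']
    exact congrArg _ (h xs (.nil c) _)
  · intro ψ
    change ProfCell (p.append q) S F G at ψ
    obtain ⟨φ, hφ⟩ := ProfCell.exists_of_append_cons (p := p) (q := q)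
      (T := (ProfData.unit C).toProf) (S := S) (F := F) (G := G)
      (fun {_ c c' _} xs t ys => S.ract
        ((functorOf G).map (ys.pull ((homEquiv c c').symm t)).2.2)
        (ψ.app (xs.append (ys.pull ((homEquiv c c').symm t)).2.1))) (by
          intro a c e b a' c' e' b' xs t ys xs' t' ys' h k l m h₁ sq h₂
          have sq' := congrArg (homEquiv _ _).symm sq
          rw [homEquiv_symm_ract, homEquiv_symm_lact] at sq'
          obtain ⟨l', h₃, h₄⟩ := Elts.pull_natural h₂ sq'
          rw [← Prof.ract_comp, ← CategoryTheory.Functor.map_comp, h₄,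
            CategoryTheory.Functor.map_comp, Prof.ract_comp, ψ.natural (h₁.append h₃),
            Prof.lact_ract])
    refine ⟨φ, fun {a c _ b} xs ys zs => ?_⟩
    cases ys
    refine (hφ xs _ zs).trans ?_
    have h := ψ.natural ((EltsHom.refl xs).append (Elts.pull_hom zs (𝟙 c)))
    rw [CategoryTheory.Functor.map_id, Prof.lact_id] at h
    change S.ract ((functorOf G).map (zs.pull ((homEquiv c c).symm (homEquiv c c (𝟙 c)))).2.2)
      (ψ.app (xs.append (zs.pull ((homEquiv c c).symm (homEquiv c c (𝟙 c)))).2.1)) = _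
    rw [Equiv.symm_apply_apply]
    exact h

/-! ### Tensors -/

section Tensor

variable {C D E : LocSmallCat κ} (hκ : κ.IsRegular) (hD : D ∈ smallCats κ) (P : Prof C D)
  (Q : Prof D E)

/-- The class of a pair of elements in the tensor. -/
noncomputable def tensorMk {c : C.carrier} {d : D.carrier} {e : E.carrier} (x : P.El c d)
    (y : Q.El d e) : (P.data.tensor hκ hD Q.data).toProf.El c e :=
  (P.data.tensor hκ hD Q.data).elEquiv c e (Quot.mk _ ⟨d, x, y⟩)

theorem exists_tensorMk {c : C.carrier} {e : E.carrier}
    (t : (P.data.tensor hκ hD Q.data).toProf.El c e) :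
    ∃ (d : D.carrier) (x : P.El c d) (y : Q.El d e), t = tensorMk hκ hD P Q x y := by
  obtain ⟨⟨d, x, y⟩, rfl⟩ := ((P.data.tensor hκ hD Q.data).elEquiv c e).surjective t
  exact ⟨d, x, y, rfl⟩

variable {P Q}

theorem tensorMk_ract_left {c : C.carrier} {d d' : D.carrier} {e : E.carrier} (x : P.El c d)
    (k : d ⟶ d') (y : Q.El d' e) :
    tensorMk hκ hD P Q (P.ract k x) y = tensorMk hκ hD P Q x (Q.lact k y) :=
  congrArg _ (Quot.sound ⟨k, rfl, rfl⟩)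

theorem lact_tensorMk {c c' : C.carrier} (h : c ⟶ c') {d : D.carrier} {e : E.carrier}
    (x : P.El c' d) (y : Q.El d e) :
    Prof.lact _ h (tensorMk hκ hD P Q x y) = tensorMk hκ hD P Q (P.lact h x) y :=
  ProfData.toProf_lact h _

theorem ract_tensorMk {c : C.carrier} {d : D.carrier} {e e' : E.carrier} (l : e ⟶ e')
    (x : P.El c d) (y : Q.El d e) :
    Prof.ract _ l (tensorMk hκ hD P Q x y) = tensorMk hκ hD P Q x (Q.ract l y) :=
  ProfData.toProf_ract l _

variable (P Q)

/-- Maps out of the tensor are the dinatural families of maps out of pairs. -/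
noncomputable def tensorLift {c : C.carrier} {e : E.carrier} {Z : Type*}
    (f : ∀ {d : D.carrier}, P.El c d → Q.El d e → Z)
    (hf : ∀ {d d' : D.carrier} (x : P.El c d) (k : d ⟶ d') (y : Q.El d' e),
      f (P.ract k x) y = f x (Q.lact k y))
    (t : (P.data.tensor hκ hD Q.data).toProf.El c e) : Z :=
  Quot.lift (fun s : Σ d, P.El c d × Q.El d e => f s.2.1 s.2.2) (by
    rintro ⟨d, x, y⟩ ⟨d', x', y'⟩ ⟨k, hx, hy⟩
    dsimp only at hx hy ⊢
    rw [hx, hy]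
    exact hf x' k y) (((P.data.tensor hκ hD Q.data).elEquiv c e).symm t)

theorem tensorLift_tensorMk {c : C.carrier} {e : E.carrier} {Z : Type*}
    (f : ∀ {d : D.carrier}, P.El c d → Q.El d e → Z)
    (hf : ∀ {d d' : D.carrier} (x : P.El c d) (k : d ⟶ d') (y : Q.El d' e),
      f (P.ract k x) y = f x (Q.lact k y)) {d : D.carrier} (x : P.El c d) (y : Q.El d e) :
    tensorLift hκ hD P Q f hf (tensorMk hκ hD P Q x y) = f x y := by
  exact congrArg (Quot.lift (fun s : Σ d, P.El c d × Q.El d e => f s.2.1 s.2.2) _)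
    (((P.data.tensor hκ hD Q.data).elEquiv c e).symm_apply_apply (Quot.mk _ ⟨d, x, y⟩))

/-- The universal 2-cell into the tensor. -/
noncomputable def tensorCell : ProfCell (.cons P (.single Q))
    (P.data.tensor hκ hD Q.data).toProf (𝟙 C) (𝟙 E) where
  app := fun | .cons x (.cons y (.nil _)) => tensorMk hκ hD P Q x y
  natural := fun
    | .cons (x := x) (y := x') (h := h) (k := k) sq
        (.cons (x := y) (y := y') (k := l) sq' (.nil _)) => by
      refine (ract_tensorMk hκ hD l x y).trans (Eq.trans ?_ (lact_tensorMk hκ hD h x' y').symm)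
      rw [sq', ← tensorMk_ract_left, sq]

/-- A 2-cell out of `p, P ⊙ Q, q` is a 2-cell out of `p, P, Q, q`, because dinaturality in the
object between `P` and `Q` is what the coend imposes. -/
theorem tensorCell_universal {A B A' B' : LocSmallCat κ} (p : HPath (Prof (κ := κ)) A C)
    (q : HPath (Prof (κ := κ)) E B) (S : Prof A' B') (F : A ⟶ A') (G : B ⟶ B') :
    Function.Bijective
      (fun φ : ProfCell (p.append (.cons (P.data.tensor hκ hD Q.data).toProf q)) S F G =>
        (profComp (((catVDC κ).idRow p).append
          (.cons (tensorCell hκ hD P Q) ((catVDC κ).idRow q) rfl)) φ :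
            ProfCell (p.append (.cons P (.cons Q q))) S (𝟙 A ≫ F) (𝟙 B ≫ G))) := by
  refine bijective_comp_idRow_cons_idRow (tensorCell hκ hD P Q) ?_ ?_
  · intro φ φ' h
    refine ProfCell.ext_append_cons fun {a c e b} xs t ys => ?_
    obtain ⟨d, x, y, rfl⟩ := exists_tensorMk hκ hD P Q t
    exact h xs (.cons x (.cons y (.nil _))) ys
  · intro ψ
    change ProfCell (p.append (.cons P (.cons Q q))) S F G at ψ
    -- Dinaturality of `ψ` in the object between `P` and `Q`.
    have hψ {a c d d' e b} (xs : Elts p a c) (x : P.El c d) (k : d ⟶ d') (y : Q.El d' e)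
        (zs : Elts q e b) : ψ.app (xs.append (.cons (P.ract k x) (.cons y zs))) =
          ψ.app (xs.append (.cons x (.cons (Q.lact k y) zs))) := by
      have := ψ.natural ((EltsHom.refl xs).append (.cons (x := x) (y := P.ract k x) (k := k)
        (by simp) (.cons (x := Q.lact k y) (y := y) (by simp) (.refl zs))))
      simpa using this.symm
    obtain ⟨φ, hφ⟩ := ProfCell.exists_of_append_cons (p := p) (q := q)
      (T := (P.data.tensor hκ hD Q.data).toProf) (S := S) (F := F) (G := G)
      (fun xs t zs => tensorLift hκ hD P Q (fun x y => ψ.app (xs.append (.cons x (.cons y zs))))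
        (fun x k y => hψ xs x k y zs) t) (by
          intro a c e b a' c' e' b' xs t zs xs' t' zs' h k l m h₁ sq h₂
          obtain ⟨d, x, y, rfl⟩ := exists_tensorMk hκ hD P Q t
          obtain ⟨d', x', y', rfl⟩ := exists_tensorMk hκ hD P Q t'
          rw [tensorLift_tensorMk, tensorLift_tensorMk]
          rw [ract_tensorMk, lact_tensorMk] at sq
          -- Equal classes need not be related by one morphism of strings: the values are compared
          -- through the lift on the common class.
          have e₁ := ψ.natural ((EltsHom.refl xs).append (.cons (x := x) (y := x) (k := 𝟙 d)
            (by simp) (.cons (x := y) (y := Q.ract l y) (k := l) (by simp) h₂)))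
          have e₂ := ψ.natural (h₁.append (.cons (x := P.lact k x') (y := x') (k := 𝟙 d')
            (by simp) (.cons (x := y') (y := y') (k := 𝟙 e') (by simp) (.refl zs'))))
          have e₃ := congrArg (tensorLift hκ hD P Q
            (fun x y => ψ.app (xs.append (.cons x (.cons y zs'))))
              (fun x k y => hψ xs x k y zs')) sq
          rw [tensorLift_tensorMk, tensorLift_tensorMk] at e₃
          simp only [CategoryTheory.Functor.map_id, Prof.lact_id, Prof.ract_id] at e₁ e₂
          rw [e₁, e₃, e₂])
    refine ⟨φ, fun {a c _ b} xs ys zs => ?_⟩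
    cases ys with
    | cons x ys =>
      cases ys with
      | cons y ys =>
        cases ys
        exact (hφ xs _ zs).trans (tensorLift_tensorMk hκ hD P Q _ _ x y)

end Tensor

/-! ### Homs -/

section Hom

variable {B C D : LocSmallCat κ} (hκ : κ.IsRegular) (hκ' : κ.IsStrongLimit)
  (hD : D ∈ smallCats κ)

section Covariant

variable (P : Prof B D) (Q : Prof C D)

/-- The elements of the covariant hom are the natural families of maps. -/
noncomputable def covHomEquiv (c : C.carrier) (b : B.carrier) :
    {α : ∀ d, P.El b d → Q.El c d //
      ∀ (d d' : D.carrier) (k : d ⟶ d') x, α d' (P.ract k x) = Q.ract k (α d x)} ≃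
        (P.data.covHom hκ hκ' hD Q.data).toProf.El c b :=
  (P.data.covHom hκ hκ' hD Q.data).elEquiv c b

variable {P Q}

/-- Evaluation of an element of the covariant hom. -/
noncomputable def covEval {c : C.carrier} {b : B.carrier} {d : D.carrier}
    (α : (P.data.covHom hκ hκ' hD Q.data).toProf.El c b) (x : P.El b d) : Q.El c d :=
  ((covHomEquiv hκ hκ' hD P Q c b).symm α).1 d x

theorem covEval_ext {c : C.carrier} {b : B.carrier}
    {α β : (P.data.covHom hκ hκ' hD Q.data).toProf.El c b}
    (h : ∀ (d : D.carrier) (x : P.El b d), covEval hκ hκ' hD α x = covEval hκ hκ' hD β x) :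
    α = β := by
  apply (covHomEquiv hκ hκ' hD P Q c b).symm.injective
  ext d x
  exact h d x

theorem covEval_ract {c : C.carrier} {b : B.carrier} {d d' : D.carrier}
    (α : (P.data.covHom hκ hκ' hD Q.data).toProf.El c b) (k : d ⟶ d') (x : P.El b d) :
    covEval hκ hκ' hD α (P.ract k x) = Q.ract k (covEval hκ hκ' hD α x) :=
  ((covHomEquiv hκ hκ' hD P Q c b).symm α).2 d d' k x

theorem covEval_ract_left {c : C.carrier} {b b' : B.carrier} {d : D.carrier}
    (α : (P.data.covHom hκ hκ' hD Q.data).toProf.El c b) (k : b ⟶ b') (x : P.El b' d) :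
    covEval hκ hκ' hD (Prof.ract _ k α) x = covEval hκ hκ' hD α (P.lact k x) :=
  congrFun (congrFun (congrArg Subtype.val (ProfData.elEquiv_symm_ract k α)) d) x

theorem covEval_lact_left {c c' : C.carrier} {b : B.carrier} {d : D.carrier}
    (α : (P.data.covHom hκ hκ' hD Q.data).toProf.El c' b) (h : c ⟶ c') (x : P.El b d) :
    covEval hκ hκ' hD (Prof.lact _ h α) x = Q.lact h (covEval hκ hκ' hD α x) :=
  congrFun (congrFun (congrArg Subtype.val (ProfData.elEquiv_symm_lact h α)) d) x

theorem covEval_covHomEquiv {c : C.carrier} {b : B.carrier} {d : D.carrier}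
    (α : {α : ∀ d, P.El b d → Q.El c d //
      ∀ (d d' : D.carrier) (k : d ⟶ d') x, α d' (P.ract k x) = Q.ract k (α d x)})
    (x : P.El b d) : covEval hκ hκ' hD (covHomEquiv hκ hκ' hD P Q c b α) x = α.1 d x := by
  unfold covEval
  rw [Equiv.symm_apply_apply]

variable (P Q)

/-- The evaluation 2-cell of the covariant hom. -/
noncomputable def covHomCell :
    ProfCell (.cons (P.data.covHom hκ hκ' hD Q.data).toProf (.single P)) Q (𝟙 C) (𝟙 D) where
  app := fun | .cons α (.cons x (.nil _)) => covEval hκ hκ' hD α x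
  natural := fun
    | .cons (x := α) (y := α') (h := h) (k := k) sq
        (.cons (x := x) (y := x') (k := l) sq' (.nil _)) => by
      change Q.ract l (covEval hκ hκ' hD α x) = Q.lact h (covEval hκ hκ' hD α' x')
      rw [← covEval_ract, sq', ← covEval_ract_left, sq, covEval_lact_left]

theorem covHomCell_universal {X : LocSmallCat κ} (p : HPath (Prof (κ := κ)) X B) (F : X ⟶ C) :
    Function.Bijective
      (fun φ : ProfCell p (P.data.covHom hκ hκ' hD Q.data).toProf F (𝟙 B) =>
        (profComp (Row.cons (G := catGraph κ) φ ((catVDC κ).idRow (.single P)) rfl)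
          (covHomCell hκ hκ' hD P Q) :
            ProfCell (p.append (.single P)) Q (F ≫ 𝟙 C) (𝟙 D ≫ 𝟙 D))) := by
  -- The composite evaluates the element of the hom given by `φ`.
  have key (φ : ProfCell p (P.data.covHom hκ hκ' hD Q.data).toProf F (𝟙 B)) {a b d}
      (xs : Elts p a b) (x : P.El b d) :
      (profComp (Row.cons (G := catGraph κ) φ ((catVDC κ).idRow (.single P)) rfl)
          (covHomCell hκ hκ' hD P Q)).app (xs.append (.cons (R := P) x (.nil d))) =
        covEval hκ hκ' hD (φ.app xs) x := by
    refine congrArg (covHomCell hκ hκ' hD P Q).app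
      ((rowApp_cons (A := X) (B := B) (C := D) (B' := B) (C' := D) φ
        ((catVDC κ).idRow (.single P)) rfl HEq.rfl).trans
          (congrArg (Elts.cons (φ.app xs)) (rowApp_idRow (.cons (R := P) x (.nil d)))))
  constructor
  · intro φ φ' h
    refine ProfCell.ext ?_
    funext a b xs
    refine covEval_ext hκ hκ' hD fun d x => ?_
    rw [← key φ, ← key φ']
    exact congrArg (fun χ => ProfCell.app χ (xs.append (.cons (R := P) x (.nil d)))) h
  · intro ψ
    change ProfCell (p.append (.single P)) Q F (𝟙 D) at ψ
    refine ⟨⟨fun {a b} xs => covHomEquiv hκ hκ' hD P Q _ b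
      ⟨fun d x => ψ.app (xs.append (.cons (R := P) x (.nil d))), ?_⟩, ?_⟩, ?_⟩
    · intro d d' k x
      have := ψ.natural ((EltsHom.refl xs).append (.cons (x := x) (y := P.ract k x) (k := k)
        (by simp) (.nil k)))
      rw [CategoryTheory.Functor.map_id, Prof.lact_id] at this
      exact this.symm
    · intro a a' b b' xs xs' h k t
      refine covEval_ext hκ hκ' hD fun d x => ?_
      refine (covEval_ract_left hκ hκ' hD _ k x).trans
        ((covEval_covHomEquiv hκ hκ' hD _ (P.lact k x)).trans (Eq.trans ?_
          ((covEval_lact_left hκ hκ' hD _ _ x).trans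
            (congrArg (Q.lact _) (covEval_covHomEquiv hκ hκ' hD _ x))).symm))
      have := ψ.natural (t.append (.cons (x := P.lact k x) (y := x) (k := 𝟙 d)
        (by simp) (.nil (𝟙 d))))
      rw [CategoryTheory.Functor.map_id, Prof.ract_id] at this
      exact this
    · refine ProfCell.ext ?_
      funext a d zs
      obtain ⟨b, xs, ys, rfl⟩ := Elts.exists_eq_append p zs
      cases ys with
      | cons x ys =>
        cases ys
        exact (key _ xs x).trans (covEval_covHomEquiv hκ hκ' hD _ x)

end Covariant

section Contravariant

variable (P : Prof D C) (Q : Prof D B)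

/-- The elements of the contravariant hom are the natural families of maps. -/
noncomputable def contraHomEquiv (b : B.carrier) (c : C.carrier) :
    {α : ∀ d, Q.El d b → P.El d c //
      ∀ (d d' : D.carrier) (k : d ⟶ d') x, α d (Q.lact k x) = P.lact k (α d' x)} ≃
        (P.data.contraHom hκ hκ' hD Q.data).toProf.El b c :=
  (P.data.contraHom hκ hκ' hD Q.data).elEquiv b c

variable {P Q}

/-- Evaluation of an element of the contravariant hom. -/
noncomputable def contraEval {b : B.carrier} {c : C.carrier} {d : D.carrier}
    (α : (P.data.contraHom hκ hκ' hD Q.data).toProf.El b c) (x : Q.El d b) : P.El d c :=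
  ((contraHomEquiv hκ hκ' hD P Q b c).symm α).1 d x

theorem contraEval_ext {b : B.carrier} {c : C.carrier}
    {α β : (P.data.contraHom hκ hκ' hD Q.data).toProf.El b c}
    (h : ∀ (d : D.carrier) (x : Q.El d b),
      contraEval hκ hκ' hD α x = contraEval hκ hκ' hD β x) : α = β := by
  apply (contraHomEquiv hκ hκ' hD P Q b c).symm.injective
  ext d x
  exact h d x

theorem contraEval_lact {b : B.carrier} {c : C.carrier} {d d' : D.carrier}
    (α : (P.data.contraHom hκ hκ' hD Q.data).toProf.El b c) (k : d ⟶ d') (x : Q.El d' b) :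
    contraEval hκ hκ' hD α (Q.lact k x) = P.lact k (contraEval hκ hκ' hD α x) :=
  ((contraHomEquiv hκ hκ' hD P Q b c).symm α).2 d d' k x

theorem contraEval_ract_left {b : B.carrier} {c c' : C.carrier} {d : D.carrier}
    (α : (P.data.contraHom hκ hκ' hD Q.data).toProf.El b c) (k : c ⟶ c') (x : Q.El d b) :
    contraEval hκ hκ' hD (Prof.ract _ k α) x = P.ract k (contraEval hκ hκ' hD α x) :=
  congrFun (congrFun (congrArg Subtype.val (ProfData.elEquiv_symm_ract k α)) d) x

theorem contraEval_lact_left {b b' : B.carrier} {c : C.carrier} {d : D.carrier}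
    (α : (P.data.contraHom hκ hκ' hD Q.data).toProf.El b' c) (h : b ⟶ b') (x : Q.El d b) :
    contraEval hκ hκ' hD (Prof.lact _ h α) x = contraEval hκ hκ' hD α (Q.ract h x) :=
  congrFun (congrFun (congrArg Subtype.val (ProfData.elEquiv_symm_lact h α)) d) x

theorem contraEval_contraHomEquiv {b : B.carrier} {c : C.carrier} {d : D.carrier}
    (α : {α : ∀ d, Q.El d b → P.El d c //
      ∀ (d d' : D.carrier) (k : d ⟶ d') x, α d (Q.lact k x) = P.lact k (α d' x)})
    (x : Q.El d b) :
    contraEval hκ hκ' hD (contraHomEquiv hκ hκ' hD P Q b c α) x = α.1 d x := by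
  unfold contraEval
  rw [Equiv.symm_apply_apply]

variable (P Q)

/-- The evaluation 2-cell of the contravariant hom. -/
noncomputable def contraHomCell :
    ProfCell (.cons Q (.single (P.data.contraHom hκ hκ' hD Q.data).toProf)) P (𝟙 D) (𝟙 C) where
  app := fun | .cons x (.cons α (.nil _)) => contraEval hκ hκ' hD α x
  natural := fun
    | .cons (x := x) (y := x') (h := h) (k := k) sq
        (.cons (x := α) (y := α') (k := l) sq' (.nil _)) => by
      change P.ract l (contraEval hκ hκ' hD α x) = P.lact h (contraEval hκ hκ' hD α' x')
      rw [← contraEval_ract_left, sq', contraEval_lact_left, sq, contraEval_lact]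

theorem contraHomCell_universal {X : LocSmallCat κ} (p : HPath (Prof (κ := κ)) B X)
    (G : X ⟶ C) :
    Function.Bijective
      (fun φ : ProfCell p (P.data.contraHom hκ hκ' hD Q.data).toProf (𝟙 B) G =>
        (profComp (Row.cons (G := catGraph κ) (profId Q) (Row.single φ) rfl)
          (contraHomCell hκ hκ' hD P Q) :
            ProfCell (.cons Q p) P (𝟙 D ≫ 𝟙 D) (G ≫ 𝟙 C))) := by
  -- The composite evaluates the element of the hom given by `φ`.
  have key (φ : ProfCell p (P.data.contraHom hκ hκ' hD Q.data).toProf (𝟙 B) G) {d b a}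
      (x : Q.El d b) (xs : Elts p b a) :
      (profComp (Row.cons (G := catGraph κ) (profId Q) (Row.single φ) rfl)
          (contraHomCell hκ hκ' hD P Q)).app (.cons x xs) =
        contraEval hκ hκ' hD (φ.app xs) x := by
    refine congrArg (contraHomCell hκ hκ' hD P Q).app
      ((rowApp_cons (A := D) (B := B) (C := X) (B' := B) (C' := C)
        (xs := .cons (R := Q) x (.nil b)) (profId Q) (Row.single φ) rfl HEq.rfl).trans
          (congrArg (Elts.cons (R := Q) x)
            (rowApp_single (A := B) (B := X) (A' := B) (B' := C) φ xs)))
  constructor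
  · intro φ φ' h
    refine ProfCell.ext ?_
    funext b a xs
    refine contraEval_ext hκ hκ' hD fun d x => ?_
    rw [← key φ, ← key φ']
    exact congrArg (fun χ => ProfCell.app χ (.cons (R := Q) x xs)) h
  · intro ψ
    change ProfCell (.cons Q p) P (𝟙 D) G at ψ
    refine ⟨⟨fun {b a} xs => contraHomEquiv hκ hκ' hD P Q b _
      ⟨fun d x => ψ.app (.cons (R := Q) x xs), ?_⟩, ?_⟩, ?_⟩
    · intro d d' k x
      have := ψ.natural (.cons (x := Q.lact k x) (y := x) (h := k) (k := 𝟙 b)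
        (by simp) (.refl xs))
      rw [CategoryTheory.Functor.map_id, Prof.ract_id] at this
      exact this
    · intro b b' a a' xs xs' h k t
      refine contraEval_ext hκ hκ' hD fun d x => ?_
      refine (contraEval_ract_left hκ hκ' hD _ _ x).trans
        ((congrArg (P.ract _) (contraEval_contraHomEquiv hκ hκ' hD _ x)).trans (Eq.trans ?_
          ((contraEval_lact_left hκ hκ' hD _ h x).trans
            (contraEval_contraHomEquiv hκ hκ' hD _ (Q.ract h x))).symm))
      have := ψ.natural (.cons (x := x) (y := Q.ract h x) (h := 𝟙 d) (by simp) t)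
      rw [CategoryTheory.Functor.map_id, Prof.lact_id] at this
      exact this
    · refine ProfCell.ext ?_
      funext d a zs
      cases zs with
      | cons x xs => exact (key _ x xs).trans (contraEval_contraHomEquiv hκ hκ' hD _ x)

end Contravariant

end Hom

/-! ### Products of profunctors -/

theorem top_universal (hκ : κ.IsRegular) {A B C D : LocSmallCat κ}
    (p : HPath (Prof (κ := κ)) A B) (F : A ⟶ C) (G : B ⟶ D) :
    Nonempty (Unique (ProfCell p (ProfData.top hκ C D).toProf F G)) := by
  have h (c d) : Subsingleton ((ProfData.top hκ C D).toProf.El c d) :=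
    ((ProfData.top hκ C D).elEquiv c d).symm.subsingleton (β := PUnit)
  exact ⟨⟨⟨fun _ => (ProfData.top hκ C D).elEquiv _ _ PUnit.unit,
    fun _ => Subsingleton.elim _ _⟩⟩, fun φ => ProfCell.ext <| by
      funext a b xs
      exact Subsingleton.elim _ _⟩

section Times

variable {C D : LocSmallCat κ} (hκ : κ.IsRegular) (P Q : Prof C D)

/-- The elements of the product are the pairs of elements. -/
noncomputable def timesEquiv (c : C.carrier) (d : D.carrier) :
    P.El c d × Q.El c d ≃ (P.data.times hκ Q.data).toProf.El c d :=
  (P.data.times hκ Q.data).elEquiv c d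

theorem timesEquiv_symm_lact {c c' : C.carrier} {d : D.carrier} (h : c ⟶ c')
    (x : (P.data.times hκ Q.data).toProf.El c' d) :
    (timesEquiv hκ P Q c d).symm (Prof.lact _ h x) =
      (P.lact h ((timesEquiv hκ P Q c' d).symm x).1,
        Q.lact h ((timesEquiv hκ P Q c' d).symm x).2) :=
  ProfData.elEquiv_symm_lact h x

theorem timesEquiv_symm_ract {c : C.carrier} {d d' : D.carrier} (k : d ⟶ d')
    (x : (P.data.times hκ Q.data).toProf.El c d) :
    (timesEquiv hκ P Q c d').symm (Prof.ract _ k x) =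
      (P.ract k ((timesEquiv hκ P Q c d).symm x).1,
        Q.ract k ((timesEquiv hκ P Q c d).symm x).2) :=
  ProfData.elEquiv_symm_ract k x

/-- The first projection. -/
noncomputable def timesFst :
    ProfCell (.single (P.data.times hκ Q.data).toProf) P (𝟙 C) (𝟙 D) where
  app := fun | .cons x (.nil _) => ((timesEquiv hκ P Q _ _).symm x).1
  natural := fun
    | .cons (h := h) (k := k) sq (.nil _) => by
      have := congrArg Prod.fst (congrArg (timesEquiv hκ P Q _ _).symm sq)
      rwa [timesEquiv_symm_ract, timesEquiv_symm_lact] at this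

/-- The second projection. -/
noncomputable def timesSnd :
    ProfCell (.single (P.data.times hκ Q.data).toProf) Q (𝟙 C) (𝟙 D) where
  app := fun | .cons x (.nil _) => ((timesEquiv hκ P Q _ _).symm x).2
  natural := fun
    | .cons (h := h) (k := k) sq (.nil _) => by
      have := congrArg Prod.snd (congrArg (timesEquiv hκ P Q _ _).symm sq)
      rwa [timesEquiv_symm_ract, timesEquiv_symm_lact] at this

theorem times_universal {A B : LocSmallCat κ} (p : HPath (Prof (κ := κ)) A B) (F : A ⟶ C)
    (G : B ⟶ D) :
    Function.Bijective (fun φ : ProfCell p (P.data.times hκ Q.data).toProf F G =>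
      ((profComp (Row.single (G := catGraph κ) φ) (timesFst hκ P Q),
        profComp (Row.single (G := catGraph κ) φ) (timesSnd hκ P Q)) :
          ProfCell p P (F ≫ 𝟙 C) (G ≫ 𝟙 D) × ProfCell p Q (F ≫ 𝟙 C) (G ≫ 𝟙 D))) := by
  have fst (φ : ProfCell p (P.data.times hκ Q.data).toProf F G) {a b} (xs : Elts p a b) :
      (profComp (Row.single (G := catGraph κ) φ) (timesFst hκ P Q)).app xs =
        ((timesEquiv hκ P Q _ _).symm (φ.app xs)).1 :=
    congrArg (timesFst hκ P Q).app (rowApp_single (A := A) (B := B) (A' := C) (B' := D) φ xs)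
  have snd (φ : ProfCell p (P.data.times hκ Q.data).toProf F G) {a b} (xs : Elts p a b) :
      (profComp (Row.single (G := catGraph κ) φ) (timesSnd hκ P Q)).app xs =
        ((timesEquiv hκ P Q _ _).symm (φ.app xs)).2 :=
    congrArg (timesSnd hκ P Q).app (rowApp_single (A := A) (B := B) (A' := C) (B' := D) φ xs)
  constructor
  · intro φ φ' h
    refine ProfCell.ext ?_
    funext a b xs
    apply (timesEquiv hκ P Q _ _).symm.injective
    refine Prod.ext ?_ ?_
    · rw [← fst φ, ← fst φ']
      exact congrArg (fun χ => ProfCell.app χ xs) (congrArg Prod.fst h)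
    · rw [← snd φ, ← snd φ']
      exact congrArg (fun χ => ProfCell.app χ xs) (congrArg Prod.snd h)
  · rintro ⟨ψ, ψ'⟩
    change ProfCell p P F G at ψ
    change ProfCell p Q F G at ψ'
    refine ⟨⟨fun xs => timesEquiv hκ P Q _ _ (ψ.app xs, ψ'.app xs), fun t => ?_⟩, ?_⟩
    · apply (timesEquiv hκ P Q _ _).symm.injective
      rw [timesEquiv_symm_ract, timesEquiv_symm_lact, Equiv.symm_apply_apply,
        Equiv.symm_apply_apply]
      exact Prod.ext (ψ.natural t) (ψ'.natural t)
    · refine Prod.ext (ProfCell.ext ?_) (ProfCell.ext ?_)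
      · funext a b xs
        refine (fst _ xs).trans ?_
        rw [Equiv.symm_apply_apply]
      · funext a b xs
        refine (snd _ xs).trans ?_
        rw [Equiv.symm_apply_apply]

end Times

/-! ### The choice of set connectives -/

/-- The set connectives of `Cat_κ`. -/
noncomputable def catSetConnectives (hκ : κ.IsRegular) (hκ' : κ.IsStrongLimit) :
    SetConnectives (catRestrictions κ) (smallCats κ) where
  unit C := ⟨(ProfData.unit C).toProf, unitCell C, unitCell_universal⟩
  tensor hD P Q := ⟨(P.data.tensor hκ hD Q.data).toProf, tensorCell hκ hD P Q,
    tensorCell_universal hκ hD P Q⟩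
  covHom hD P Q := ⟨(P.data.covHom hκ hκ' hD Q.data).toProf, covHomCell hκ hκ' hD P Q,
    covHomCell_universal hκ hκ' hD P Q⟩
  contraHom hD P Q := ⟨(P.data.contraHom hκ hκ' hD Q.data).toProf, contraHomCell hκ hκ' hD P Q,
    contraHomCell_universal hκ hκ' hD P Q⟩
  top C D := ⟨(ProfData.top hκ C D).toProf, top_universal hκ⟩
  times P Q := ⟨(P.data.times hκ Q.data).toProf, timesFst hκ P Q, timesSnd hκ P Q,
    times_universal hκ P Q⟩
  tensor_restr hD P Q F G := by
    change profRestr F G (P.data.tensor hκ hD Q.data).toProf =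
      ((profRestr F (𝟙 _) P).data.tensor hκ hD (profRestr (𝟙 _) G Q).data).toProf
    rw [data_profRestr, data_profRestr]
    rfl
  covHom_restr hD P Q F G := by
    change profRestr F G (P.data.covHom hκ hκ' hD Q.data).toProf =
      ((profRestr G (𝟙 _) P).data.covHom hκ hκ' hD (profRestr F (𝟙 _) Q).data).toProf
    rw [data_profRestr, data_profRestr]
    rfl
  contraHom_restr hD P Q F G := by
    change profRestr F G (P.data.contraHom hκ hκ' hD Q.data).toProf =
      ((profRestr (𝟙 _) G P).data.contraHom hκ hκ' hD (profRestr (𝟙 _) F Q).data).toProf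
    rw [data_profRestr, data_profRestr]
    rfl
  top_restr _ _ := rfl
  times_restr P Q F G := by
    change profRestr F G (P.data.times hκ Q.data).toProf =
      ((profRestr F G P).data.times hκ (profRestr F G Q).data).toProf
    rw [data_profRestr, data_profRestr]
    rfl

/-! ### Terminal category, products and tabulators -/

/-- The category with one object and one morphism. -/
def terminalCat (hκ : κ.IsRegular) : LocSmallCat κ where
  carrier := PUnit
  category := { Hom := fun _ _ => PUnit, id := fun _ => ⟨⟩, comp := fun _ _ => ⟨⟩ }
  hom_lt _ _ := (hasCardinalLT_iff_cardinal_mk_lt PUnit κ).mp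
    (hasCardinalLT_of_finite _ _ hκ.aleph0_le)

theorem terminalCat_universal (hκ : κ.IsRegular) (A : LocSmallCat κ) :
    Nonempty (Unique (A ⟶ terminalCat hκ)) :=
  ⟨⟨⟨{ obj := fun _ => PUnit.unit, map := fun _ => PUnit.unit, map_id := fun _ => rfl,
       map_comp := fun _ _ => rfl }⟩, fun _ => rfl⟩⟩

theorem terminalCat_small (hκ : κ.IsRegular) : terminalCat hκ ∈ smallCats κ := by
  have : Finite (Arrow (terminalCat hκ).carrier) :=
    Finite.of_injective (fun _ => PUnit.unit.{1}) fun
      | ⟨⟨⟩, ⟨⟩, ⟨⟩⟩, ⟨⟨⟩, ⟨⟩, ⟨⟩⟩, _ => rfl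
  exact hasCardinalLT_of_finite _ _ hκ.aleph0_le

/-- The product of two categories. -/
def prodCat (hκ : κ.IsRegular) (B C : LocSmallCat κ) : LocSmallCat κ where
  carrier := B.carrier × C.carrier
  hom_lt x y := (hasCardinalLT_iff_cardinal_mk_lt _ κ).mp
    (hasCardinalLT_prod hκ.aleph0_le
      ((hasCardinalLT_iff_cardinal_mk_lt _ κ).mpr (B.hom_lt x.1 y.1))
      ((hasCardinalLT_iff_cardinal_mk_lt _ κ).mpr (C.hom_lt x.2 y.2)))

/-- The universal property of the product of two categories. -/
def prodCatProduct (hκ : κ.IsRegular) (B C : LocSmallCat κ) :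
    ProductObject (V := catVDC κ) B C where
  obj := prodCat hκ B C
  equiv _ :=
    { toFun := fun H => (functorOf H ⋙ CategoryTheory.Prod.fst B.carrier C.carrier,
        functorOf H ⋙ CategoryTheory.Prod.snd B.carrier C.carrier)
      invFun := fun F => (functorOf F.1).prod' (functorOf F.2)
      left_inv := fun _ => rfl
      right_inv := fun _ => rfl }
  natural _ _ := rfl

theorem prodCat_small (hκ : κ.IsRegular) {B C : LocSmallCat κ} (hB : B ∈ smallCats κ)
    (hC : C ∈ smallCats κ) : prodCat hκ B C ∈ smallCats κ := by
  refine HasCardinalLT.of_injective (hasCardinalLT_prod hκ.aleph0_le hB hC)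
    (fun f : Arrow (B.carrier × C.carrier) => (Arrow.mk f.hom.1, Arrow.mk f.hom.2)) ?_
  rintro ⟨⟨b, c⟩, ⟨b', c'⟩, ⟨h, k⟩⟩ ⟨⟨b₁, c₁⟩, ⟨b₁', c₁'⟩, ⟨h₁, k₁⟩⟩ e
  obtain ⟨e₁, e₂⟩ := Prod.mk.inj e
  cases e₁
  cases e₂
  rfl

section Tabulator

variable {B C : LocSmallCat κ}

/-- The elements of a profunctor, over arbitrary pairs of objects. -/
structure Prof.Element (R : Prof B C) where
  fst : B.carrier
  snd : C.carrier
  elt : R.El fst snd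

/-- Elements of a profunctor form a category, in which a morphism is a pair of morphisms
compatible with the elements. -/
instance (R : Prof B C) : Category.{u} R.Element where
  Hom s t := {h : (s.fst ⟶ t.fst) × (s.snd ⟶ t.snd) // R.ract h.2 s.elt = R.lact h.1 t.elt}
  id s := ⟨(𝟙 _, 𝟙 _), by simp⟩
  comp f g := ⟨(f.1.1 ≫ g.1.1, f.1.2 ≫ g.1.2), by
    rw [Prof.ract_comp, f.2, ← Prof.lact_ract, g.2, Prof.lact_comp]⟩
  id_comp f := Subtype.ext (Prod.ext (Category.id_comp _) (Category.id_comp _))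
  comp_id f := Subtype.ext (Prod.ext (Category.comp_id _) (Category.comp_id _))
  assoc f g h := Subtype.ext (Prod.ext (Category.assoc _ _ _) (Category.assoc _ _ _))

/-- The tabulator of a profunctor: its category of elements. -/
def tabCat (hκ : κ.IsRegular) (R : Prof B C) : LocSmallCat κ where
  carrier := R.Element
  hom_lt s t := (hasCardinalLT_iff_cardinal_mk_lt _ κ).mp
    (HasCardinalLT.of_injective (hasCardinalLT_prod hκ.aleph0_le
      ((hasCardinalLT_iff_cardinal_mk_lt _ κ).mpr (B.hom_lt s.fst t.fst))
      ((hasCardinalLT_iff_cardinal_mk_lt _ κ).mpr (C.hom_lt s.snd t.snd)))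
        (fun h : {h : (s.fst ⟶ t.fst) × (s.snd ⟶ t.snd) //
          R.ract h.2 s.elt = R.lact h.1 t.elt} => h.1) Subtype.val_injective)

/-- The universal property of the tabulator. -/
def tabCatTabulator (hκ : κ.IsRegular) (R : Prof B C) :
    Tabulator (V := catVDC κ) (B := B) (C := C) R where
  obj := tabCat hκ R
  equiv A :=
    { toFun := fun H =>
        let H' : A.carrier ⥤ R.Element := H
        ⟨{ obj := fun a => (H'.obj a).fst, map := fun h => (H'.map h).1.1,
           map_id := fun a => by rw [H'.map_id]; rfl,
           map_comp := fun h k => by rw [H'.map_comp]; rfl },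
         { obj := fun a => (H'.obj a).snd, map := fun h => (H'.map h).1.2,
           map_id := fun a => by rw [H'.map_id]; rfl,
           map_comp := fun h k => by rw [H'.map_comp]; rfl },
         { app := fun | .nil a => (H'.obj a).elt
           natural := fun | .nil h => (H'.map h).2 }⟩
      invFun := fun s =>
        { obj := fun a => ⟨(functorOf s.1).obj a, (functorOf s.2.1).obj a,
            ProfCell.app s.2.2 (.nil a)⟩
          map := fun h => ⟨((functorOf s.1).map h, (functorOf s.2.1).map h),
            ProfCell.natural s.2.2 (.nil h)⟩
          map_id := fun a => Subtype.ext
            (Prod.ext ((functorOf s.1).map_id a) ((functorOf s.2.1).map_id a))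
          map_comp := fun h k => Subtype.ext
            (Prod.ext ((functorOf s.1).map_comp h k) ((functorOf s.2.1).map_comp h k)) }
      left_inv := fun _ => rfl
      right_inv := fun s => by
        refine Sigma.ext rfl (heq_of_eq (Sigma.ext rfl (heq_of_eq (ProfCell.ext ?_))))
        funext a a' xs
        cases xs
        rfl }
  natural k H := by
    refine Sigma.ext rfl (heq_of_eq (Sigma.ext rfl (heq_of_eq (ProfCell.ext ?_))))
    funext a a' xs
    cases xs
    rfl

theorem tabCat_small (hκ : κ.IsRegular) (R : Prof B C) (hB : B ∈ smallCats κ)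
    (hC : C ∈ smallCats κ) : tabCat hκ R ∈ smallCats κ := by
  have : Fact κ.IsRegular := ⟨hκ⟩
  refine HasCardinalLT.of_injective (hasCardinalLT_sigma
    (fun f : Arrow B.carrier × Arrow C.carrier =>
      R.El f.1.left f.2.left × R.El f.1.right f.2.right) κ
    (hasCardinalLT_prod hκ.aleph0_le hB hC)
    (fun f => hasCardinalLT_prod hκ.aleph0_le (R.hasCardinalLT_el _ _) (R.hasCardinalLT_el _ _)))
    (fun f : Arrow R.Element => ⟨(Arrow.mk f.hom.1.1, Arrow.mk f.hom.1.2),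
      (f.left.elt, f.right.elt)⟩) ?_
  rintro ⟨⟨b, c, x⟩, ⟨b', c', x'⟩, ⟨⟨h, k⟩, w⟩⟩ ⟨⟨b₁, c₁, x₁⟩, ⟨b₁', c₁', x₁'⟩, ⟨⟨h₁, k₁⟩, w₁⟩⟩ e
  obtain ⟨e₁, e₂⟩ := Sigma.mk.inj e
  obtain ⟨e₃, e₄⟩ := Prod.mk.inj e₁
  cases e₃
  cases e₄
  obtain ⟨e₅, e₆⟩ := Prod.mk.inj (eq_of_heq e₂)
  cases e₅
  cases e₆
  rfl

end Tabulator

/-! ### Presheaf categories -/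

theorem hasCardinalLT_natTrans (hκ : κ.IsRegular) (hκ' : κ.IsStrongLimit) {J : Type (u + 1)}
    [Category.{u} J] (hJ : HasCardinalLT J κ) (X Y : J ⥤ KSet κ) : HasCardinalLT (X ⟶ Y) κ := by
  refine (hasCardinalLT_pi_fun hκ hκ' hJ
    (fun j => (hasCardinalLT_iff_cardinal_mk_lt _ _).mpr (X.obj j).property)
    (fun j => (hasCardinalLT_iff_cardinal_mk_lt _ _).mpr (Y.obj j).property)).of_injective
      (fun α j x => (α.app j).hom x) ?_
  intro α β h
  ext j x
  exact congrFun (congrFun h j) x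

/-- The category of functors from a category with fewer than `κ` objects to sets of cardinality
less than `κ`, on small models of the sets of natural transformations. -/
noncomputable def presheafCat (hκ : κ.IsRegular) (hκ' : κ.IsStrongLimit) {J : Type (u + 1)}
    [Category.{u} J] (hJ : HasCardinalLT J κ) : LocSmallCat κ :=
  have : LocallySmall.{u} (J ⥤ KSet κ) :=
    ⟨fun X Y => (hasCardinalLT_natTrans hκ hκ' hJ X Y).small⟩
  { carrier := ShrinkHoms.{u + 1} (J ⥤ KSet κ)
    hom_lt := fun X Y => by
      rw [← hasCardinalLT_iff_cardinal_mk_lt]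
      exact (hasCardinalLT_iff_of_equiv (equivShrink.{u} _) κ).mp
        (hasCardinalLT_natTrans hκ hκ' hJ (ShrinkHoms.fromShrinkHoms X)
          (ShrinkHoms.fromShrinkHoms Y)) }

/-- Functors into `ShrinkHoms X` are the same as functors into `X`. -/
noncomputable def functorShrinkHomsEquiv (A : Type*) [Category* A] (X : Type*) [Category* X]
    [LocallySmall.{u} X] : A ⥤ ShrinkHoms.{_} X ≃ A ⥤ X where
  toFun F := F ⋙ ShrinkHoms.inverse X
  invFun F := F ⋙ ShrinkHoms.functor X
  left_inv F := by
    refine CategoryTheory.Functor.hext (fun _ => rfl) fun a b f => heq_of_eq ?_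
    exact (equivShrink _).apply_symm_apply (F.map f)
  right_inv F := by
    refine CategoryTheory.Functor.hext (fun _ => rfl) fun a b f => heq_of_eq ?_
    exact (equivShrink _).symm_apply_apply (F.map f)

/-- Vertical arrows into a presheaf category are functors into the category of functors. -/
noncomputable def functorPresheafCatEquiv (hκ : κ.IsRegular) (hκ' : κ.IsStrongLimit)
    {J : Type (u + 1)} [Category.{u} J] (hJ : HasCardinalLT J κ) (A : Type (u + 1))
    [Category.{u} A] : A ⥤ (presheafCat hκ hκ' hJ).carrier ≃ A ⥤ J ⥤ KSet κ :=
  have : LocallySmall.{u} (J ⥤ KSet κ) :=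
    ⟨fun X Y => (hasCardinalLT_natTrans hκ hκ' hJ X Y).small⟩
  functorShrinkHomsEquiv A (J ⥤ KSet κ)

theorem hasCardinalLT_op {C : LocSmallCat κ} (hC : C ∈ smallCats κ) :
    HasCardinalLT C.carrierᵒᵖ κ :=
  (hasCardinalLT_iff_of_equiv equivToOpposite κ).mp (hasCardinalLT_carrier hC)

/-- The contravariant presheaf object of a small category. -/
noncomputable def catNegPresheaf (hκ : κ.IsRegular) (hκ' : κ.IsStrongLimit) {C : LocSmallCat κ}
    (hC : C ∈ smallCats κ) : NegPresheafObject (V := catVDC κ) (catRestrictions κ) C where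
  obj := presheafCat hκ hκ' (hasCardinalLT_op hC)
  equiv A := (functorPresheafCatEquiv hκ hκ' (hasCardinalLT_op hC) A.carrier).trans
    CategoryTheory.Functor.curryingFlipEquiv
  natural _ _ := rfl

/-- The opposite category. -/
def opCat (C : LocSmallCat κ) : LocSmallCat κ where
  carrier := C.carrierᵒᵖ
  hom_lt x y := by
    rw [← hasCardinalLT_iff_cardinal_mk_lt, hasCardinalLT_iff_of_equiv (opEquiv x y),
      hasCardinalLT_iff_cardinal_mk_lt]
    exact C.hom_lt _ _

/-- Functors into an opposite category are functors out of an opposite category. -/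
def functorOpEquiv (A X : Type*) [Category* A] [Category* X] : A ⥤ Xᵒᵖ ≃ Aᵒᵖ ⥤ X where
  toFun F := F.leftOp
  invFun F := F.rightOp
  left_inv _ := rfl
  right_inv _ := rfl

/-- The covariant presheaf object of a small category. -/
noncomputable def catPosPresheaf (hκ : κ.IsRegular) (hκ' : κ.IsStrongLimit) {C : LocSmallCat κ}
    (hC : C ∈ smallCats κ) : PosPresheafObject (V := catVDC κ) (catRestrictions κ) C where
  obj := opCat (presheafCat hκ hκ' (hasCardinalLT_carrier hC))
  equiv A := ((functorOpEquiv A.carrier _).trans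
    (functorPresheafCatEquiv hκ hκ' (hasCardinalLT_carrier hC) A.carrierᵒᵖ)).trans
      CategoryTheory.Functor.curryingEquiv
  natural _ _ := rfl

/-- The category connectives of `Cat_κ`. -/
noncomputable def catCategoryConnectives (hκ : κ.IsRegular) (hκ' : κ.IsStrongLimit) :
    CategoryConnectives (catRestrictions κ) (smallCats κ) where
  one := terminalCat hκ
  one_universal := terminalCat_universal hκ
  one_small := terminalCat_small hκ
  prod := prodCatProduct hκ
  prod_small _ _ := prodCat_small hκ
  tabulator := tabCatTabulator hκ
  tabulator_small := tabCat_small hκ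
  negPresheaf _ := catNegPresheaf hκ hκ'
  posPresheaf _ := catPosPresheaf hκ hκ'

end VETT

theorem mainTheorem6 (κ : Cardinal.{u}) :
    (VETT.catVDC κ).IsVirtualDoubleCategory ∧
    (VETT.catRestrictions κ).IsSplitFibrant ∧
    (κ.IsRegular → κ.IsStrongLimit →
      Nonempty (VETT.CategoryConnectives (VETT.catRestrictions κ) (VETT.smallCats κ)) ∧
      Nonempty (VETT.SetConnectives (VETT.catRestrictions κ) (VETT.smallCats κ))) :=
  ⟨VETT.catVDC_isVirtualDoubleCategory κ, VETT.catRestrictions_isSplitFibrant κ,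
    fun hκ hκ' => ⟨⟨VETT.catCategoryConnectives hκ hκ'⟩, ⟨VETT.catSetConnectives hκ hκ'⟩⟩⟩
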